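/- Let $1<R<\infty$, let $\mathbb A=\{z\in\mathbb C: 1<|z|<R\}$, and let $\mathcal A\subset\mathbb C$ be a doubly connected domain (an open connected set) whose complement in the Riemann sphere $\widehat{\mathbb C}$ is the disjoint union of the closed unit disk $\{|z|\le 1\}$ and a closed connected set containing $\infty$. Let $\mathcal H(\mathbb A,\mathcal A)$ be the class of orientation preserving complex-valued harmonic homeomorphisms $h$ of $\mathbb A$ onto $\mathcal A$ whose cluster set at the inner circle $\{|z|=1\}$ of $\mathbb A$ is the inner boundary $\{|w|=1\}$ of $\mathcal A$. For $1<\rho<R$ write $\langle f\rangle_\rho=\frac1{2\pi}\int_0^{2\pi}f(\rho e^{i\theta})\,d\theta$ for the average of $f$ over the circle $|z|=\rho$. Suppose that $h\in\mathcal H(\mathbb A,\mathcal A)$ satisfies at least one of the following conditions: (i) $\displaystyle\lim_{\rho\searrow1}\langle h\rangle_\rho=0$; (ii) $\displaystyle\Big\langle\frac{\partial h}{\partial\rho}\Big\rangle_\rho=0$ for some $\rho\in(1,R)$ (equivalently, for all $\rho\in(1,R)$), where $\frac{\partial h}{\partial \rho}$ is the radial derivative. Then the limit $\displaystyle R_*(h)=\lim_{\rho\nearrow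 R}\big\langle|h|^2\big\rangle_\rho^{1/2}$ exists in $[0,\infty]$, and $$R_*(h)\ \ge\ \frac12\Big(R+\frac1R\Big).$$ -/

import Mathlib

open Filter Topology
open scoped ENNReal

namespace Nitsche

noncomputable section

/-- The round annulus `A(1, R) = {z : 1 < |z| < R}`. -/
def annulus (R : ℝ) : Set ℂ := {z | 1 < ‖z‖ ∧ ‖z‖ < R}

/-- A half round annulus: a doubly connected planar domain `𝒜` whose complement in the Riemann
sphere has as its components the closed unit disk (the inner one) and a closed connected set
containing `∞` (the outer one). -/
structure IsHalfRoundAnnulus (𝒜 : Set ℂ) : Prop where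
  isOpen : IsOpen 𝒜
  isConnected : IsConnected 𝒜
  compl_eq : ∃ outer : Set (OnePoint ℂ), IsClosed outer ∧ IsConnected outer ∧
    OnePoint.infty ∈ outer ∧
    Disjoint (((↑) : ℂ → OnePoint ℂ) '' Metric.closedBall 0 1) outer ∧
    (((↑) : ℂ → OnePoint ℂ) '' 𝒜)ᶜ =
      ((↑) : ℂ → OnePoint ℂ) '' Metric.closedBall 0 1 ∪ outer

/-- The curve `γ`, parametrized by `[0, 2π]`, avoids the point `w` and has winding number `n`
about it: a continuous branch of `arg (γ - w)` increases by `2πn` along `γ`. -/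
def HasWindingNumber (γ : ℝ → ℂ) (w : ℂ) (n : ℤ) : Prop :=
  (∀ t ∈ Set.Icc 0 (2 * Real.pi), γ t ≠ w) ∧
    ∃ φ : ℝ → ℝ, ContinuousOn φ (Set.Icc 0 (2 * Real.pi)) ∧
      (∀ t ∈ Set.Icc 0 (2 * Real.pi),
        γ t - w = (‖γ t - w‖ : ℂ) * Complex.exp ((φ t : ℂ) * Complex.I)) ∧
      φ (2 * Real.pi) - φ 0 = 2 * Real.pi * n

/-- A homeomorphism `h` of the open set `Ω` onto its image preserves orientation if it has local
degree `1` at each point `z` of `Ω`: the images of small positively oriented circles around `z`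
wind once, in the positive sense, around `h z`. -/
def OrientationPreservingOn (h : ℂ → ℂ) (Ω : Set ℂ) : Prop :=
  ∀ z ∈ Ω, ∀ᶠ ε in 𝓝[>] (0 : ℝ), HasWindingNumber (fun t => h (circleMap z ε t)) (h z) 1

/-- The cluster set, in the Riemann sphere, of `h : Ω → ℂ` at a set `C` of boundary points. -/
def clusterSet (h : ℂ → ℂ) (Ω C : Set ℂ) : Set (OnePoint ℂ) :=
  {w | ∃ ζ ∈ C, MapClusterPt w (𝓝[Ω] ζ) (fun z => (h z : OnePoint ℂ))}

/-- The class `ℋ(𝔸, 𝒜)`, where `𝔸 = A(1, R)` and `𝒜` is a half round annulus: orientation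
preserving harmonic homeomorphisms of `𝔸` onto `𝒜` whose cluster set at the inner circle of `𝔸`
is the inner boundary (the unit circle) of `𝒜`. -/
structure IsHarmonicMap (R : ℝ) (𝒜 : Set ℂ) (h : ℂ → ℂ) : Prop where
  harmonic : InnerProductSpace.HarmonicOnNhd h (annulus R)
  isEmbedding : IsEmbedding ((annulus R).domRestrict h)
  image_eq : h '' annulus R = 𝒜
  orientation : OrientationPreservingOn h (annulus R)
  cluster_inner : clusterSet h (annulus R) (Metric.sphere 0 1) =
    ((↑) : ℂ → OnePoint ℂ) '' Metric.sphere 0 1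

/-- The normal (radial) derivative `∂h/∂ρ` at `z = ρ e^{iθ}`. -/
def radialDeriv (h : ℂ → ℂ) (z : ℂ) : ℂ := fderiv ℝ h z (z / (‖z‖ : ℂ))

/-- The subclass `ℋ_D(𝔸, 𝒜)` of mappings with vanishing average on the inner circle. -/
def IsHarmonicMapD (R : ℝ) (𝒜 : Set ℂ) (h : ℂ → ℂ) : Prop :=
  IsHarmonicMap R 𝒜 h ∧ Tendsto (fun ρ => Real.circleAverage h 0 ρ) (𝓝[>] 1) (𝓝 0)

/-- The subclass `ℋ_N(𝔸, 𝒜)` of mappings whose normal derivative has vanishing average on some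
circle `|z| = ρ` with `1 < ρ < R` (equivalently, on all of them). -/
def IsHarmonicMapN (R : ℝ) (𝒜 : Set ℂ) (h : ℂ → ℂ) : Prop :=
  IsHarmonicMap R 𝒜 h ∧ ∃ ρ ∈ Set.Ioo 1 R, Real.circleAverage (radialDeriv h) 0 ρ = 0

/-- `L ∈ [0, ∞]` is the mean outer radius `R_*(h)`, the limit of the `L²` means of `h` on the
circles `|z| = ρ` as `ρ ↗ R`. -/
def IsMeanOuterRadius (R : ℝ) (h : ℂ → ℂ) (L : ℝ≥0∞) : Prop :=
  Tendsto (fun ρ => ENNReal.ofReal (Real.sqrt (Real.circleAverage (fun z => ‖h z‖ ^ 2) 0 ρ)))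
    (𝓝[<] R) (𝓝 L)

end

end Nitsche

namespace Nitsche

open MeasureTheory Set Real ComplexConjugate

/-! ### Differentiation under the integral sign -/

/-! Write `G t s = h (exp (t + i s))` on the strip `0 < t < log R` and let `E t` be the integral of
`|G t s|²` over a period in `s`. Since `cosh (log R) = (R + 1/R) / 2`, it suffices that `E` is
nondecreasing and `E T ≥ 2π cosh² T`.

The image lies outside the unit disk and its inner cluster set is the unit circle, so `E ≥ 2π` and
`E → 2π` at the left end. As `E` is convex, `E' ≥ 0` (`circleInner_nonneg`).

The Fourier coefficients solve `fₙ'' = n² fₙ`. For `n ≠ 0`, `single_mode_ineq` bounds `(1 + |n|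
sinh² (T - ε)) |fₙ(ε)|²` by `|fₙ(T)|²` minus a positive multiple of `Re (conj fₙ · fₙ') (ε)`, with
the same multiple for every `n`. After summation by Parseval the subtracted terms add up to a
multiple of `E'(ε) ≥ 0` and can be dropped; then `ε → 0`.

Only the mode `n = 0`, affine in `t`, needs the extra hypothesis. Under (i) the weights are at least
`cosh²` for `n ≠ 0`, and the defect at `n = 0` tends to `0` with `f₀(ε)`. Under (ii) `f₀` is
constant, and `∑ n |fₙ|²` measures the area enclosed by the image of a circle, so that area must be
at least `π` (`two_pi_le_sweptArea`). This follows from Green's formula with cut-off weights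
(`hasDerivAt_circulation`): preservation of orientation makes the Jacobian nonnegative, and
injectivity with open image keeps it from vanishing on an open set. -/

theorem hasDerivAt_intervalIntegral_of_continuousOn {E : Type*} [NormedAddCommGroup E]
    [NormedSpace ℝ E] {a b : ℝ} {I : Set ℝ} (hI : IsOpen I) {F F' : ℝ → ℝ → E}
    (hF : ContinuousOn (fun p : ℝ × ℝ => F p.1 p.2) (I ×ˢ univ))
    (hF' : ContinuousOn (fun p : ℝ × ℝ => F' p.1 p.2) (I ×ˢ univ))
    (hd : ∀ t ∈ I, ∀ s, HasDerivAt (fun t => F t s) (F' t s) t) {t : ℝ} (ht : t ∈ I) :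
    HasDerivAt (fun t => ∫ s in a..b, F t s) (∫ s in a..b, F' t s) t := by
  have slice : ∀ {H : ℝ → ℝ → E}, ContinuousOn (fun p : ℝ × ℝ => H p.1 p.2) (I ×ˢ univ) →
      ∀ x ∈ I, Continuous (H x) := fun {H} hH x hx =>
    hH.comp_continuous (f := fun s => (x, s)) (by fun_prop) (fun s => ⟨hx, mem_univ s⟩)
  obtain ⟨r, hr, hrI⟩ := Metric.nhds_basis_closedBall.mem_iff.1 (hI.mem_nhds ht)
  have hK : IsCompact (Metric.closedBall t r ×ˢ uIcc a b) :=
    (isCompact_closedBall t r).prod isCompact_uIcc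
  obtain ⟨C, hC⟩ := hK.exists_bound_of_continuousOn
    (hF'.mono (prod_mono hrI (subset_univ _)))
  refine (intervalIntegral.hasDerivAt_integral_of_dominated_loc_of_deriv_le
    (bound := fun _ => C) (Metric.closedBall_mem_nhds t hr) ?_
    ((slice hF t ht).intervalIntegrable _ _) (slice hF' t ht).aestronglyMeasurable ?_
    (by simp) ?_).2
  · filter_upwards [hI.mem_nhds ht] with x hx
    exact (slice hF x hx).aestronglyMeasurable
  · exact Eventually.of_forall fun s hs x hx => hC (x, s) ⟨hx, uIoc_subset_uIcc hs⟩
  · exact Eventually.of_forall fun s _ x hx => hd x (hrI hx) s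

/-! ### Fourier coefficients on `[0, 2π]` -/

/-- The unnormalized Fourier coefficient `∫ e^{-inθ} u(θ) dθ` over `[0, 2π]`. -/
noncomputable def fourierInt (u : ℝ → ℂ) (n : ℤ) : ℂ :=
  ∫ θ in (0 : ℝ)..2 * π, Complex.exp (-(n * θ * Complex.I)) * u θ

theorem fourierInt_add {u v : ℝ → ℂ} (hu : Continuous u) (hv : Continuous v) (n : ℤ) :
    fourierInt (fun θ => u θ + v θ) n = fourierInt u n + fourierInt v n := by
  simp only [fourierInt, mul_add]
  exact intervalIntegral.integral_add (Continuous.intervalIntegrable (by fun_prop) _ _)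
    (Continuous.intervalIntegrable (by fun_prop) _ _)

theorem fourierInt_sub {u v : ℝ → ℂ} (hu : Continuous u) (hv : Continuous v) (n : ℤ) :
    fourierInt (fun θ => u θ - v θ) n = fourierInt u n - fourierInt v n := by
  simp only [fourierInt, mul_sub]
  exact intervalIntegral.integral_sub (Continuous.intervalIntegrable (by fun_prop) _ _)
    (Continuous.intervalIntegrable (by fun_prop) _ _)

theorem fourierInt_const_mul (c : ℂ) (u : ℝ → ℂ) (n : ℤ) :
    fourierInt (fun θ => c * u θ) n = c * fourierInt u n := by
  simp only [fourierInt, mul_left_comm _ c, intervalIntegral.integral_const_mul]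

theorem fourierInt_zero (u : ℝ → ℂ) : fourierInt u 0 = ∫ θ in (0 : ℝ)..2 * π, u θ := by
  simp [fourierInt]

/-- Parseval's identity. -/
theorem hasSum_sq_fourierInt {u : ℝ → ℂ} (hu : Continuous u) :
    HasSum (fun n => ‖fourierInt u n‖ ^ 2) (2 * π * ∫ θ in (0 : ℝ)..2 * π, ‖u θ‖ ^ 2) := by
  have h2 : MemLp u 2 (volume.restrict (Ioc 0 (2 * π))) :=
    (memLp_two_iff_integrable_sq_norm hu.aestronglyMeasurable).2
      ((intervalIntegrable_iff_integrableOn_Ioc_of_le two_pi_pos.le).1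
        (Continuous.intervalIntegrable (by fun_prop) 0 (2 * π)))
  -- The normalized coefficients carry a factor `1 / (2π)`, hence the rescaling by its inverse
  -- square.
  have h := (hasSum_sq_fourierCoeffOn two_pi_pos h2).mul_left ((2 * π) ^ 2)
  convert! h using 1
  · ext n
    rw [fourierCoeffOn_eq_integral, norm_smul]
    have : ∀ θ : ℝ, (fourier (-n) (θ : AddCircle (2 * π - 0)) : ℂ) • u θ =
        Complex.exp (-(n * θ * Complex.I)) * u θ := by
      intro θ
      rw [fourier_coe_apply, smul_eq_mul]
      congr 2
      have : (π : ℂ) ≠ 0 := by exact_mod_cast pi_ne_zero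
      push_cast
      field_simp
      ring
    simp only [this]
    change ‖fourierInt u n‖ ^ 2 = (2 * π) ^ 2 * (‖1 / (2 * π - 0)‖ * ‖fourierInt u n‖) ^ 2
    rw [sub_zero, norm_of_nonneg (by positivity)]
    field_simp
  · simp only [sub_zero, smul_eq_mul]
    field_simp

/-- Parseval's identity, polarized. -/
theorem hasSum_inner_fourierInt {u v : ℝ → ℂ} (hu : Continuous u) (hv : Continuous v) :
    HasSum (fun n => (conj (fourierInt u n) * fourierInt v n).re)
      (2 * π * ∫ θ in (0 : ℝ)..2 * π, (conj (u θ) * v θ).re) := by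
  have key : ∀ z w : ℂ, (conj z * w).re = (‖z + w‖ ^ 2 - ‖z - w‖ ^ 2) * (1 / 4) := by
    intro z w
    simp only [Complex.sq_norm, Complex.normSq_apply, Complex.mul_re, Complex.conj_re,
      Complex.conj_im, Complex.add_re, Complex.add_im, Complex.sub_re, Complex.sub_im]
    ring
  have h := ((hasSum_sq_fourierInt (hu.add hv)).sub (hasSum_sq_fourierInt (hu.sub hv))).mul_right
    (1 / 4)
  simp only [Pi.add_def, Pi.sub_def, fourierInt_add hu hv, fourierInt_sub hu hv] at h
  convert! h using 1
  · ext n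
    rw [key]
  · simp only [key, intervalIntegral.integral_mul_const]
    rw [intervalIntegral.integral_sub (Continuous.intervalIntegrable (by fun_prop) _ _)
      (Continuous.intervalIntegrable (by fun_prop) _ _)]
    ring

/-- Integration by parts: differentiation multiplies the `n`-th Fourier coefficient by `in`. -/
theorem fourierInt_deriv {u u' : ℝ → ℂ} (hu : ∀ θ, HasDerivAt u (u' θ) θ) (hu' : Continuous u')
    (hper : u (2 * π) = u 0) (n : ℤ) :
    fourierInt u' n = n * Complex.I * fourierInt u n := by
  have hc : Continuous u := continuous_iff_continuousAt.2 fun θ => (hu θ).continuousAt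
  have hd : ∀ θ : ℝ, HasDerivAt (fun θ : ℝ => Complex.exp (-(n * θ * Complex.I)) * u θ)
      (Complex.exp (-(n * θ * Complex.I)) * u' θ -
        n * Complex.I * (Complex.exp (-(n * θ * Complex.I)) * u θ)) θ := by
    intro θ
    have h1 : HasDerivAt (fun θ : ℝ => -((n : ℂ) * θ * Complex.I)) (-(n * 1 * Complex.I)) θ :=
      ((((hasDerivAt_id (θ : ℂ)).comp_ofReal).const_mul (n : ℂ)).mul_const Complex.I).neg
    exact (h1.cexp.mul (hu θ)).congr_deriv (by simp; ring)
  have h := intervalIntegral.integral_eq_sub_of_hasDerivAt (a := 0) (b := 2 * π)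
    (fun θ _ => hd θ) (Continuous.intervalIntegrable (by fun_prop) _ _)
  rw [intervalIntegral.integral_sub (Continuous.intervalIntegrable (by fun_prop) _ _)
    (Continuous.intervalIntegrable (by fun_prop) _ _), intervalIntegral.integral_const_mul] at h
  have he : Complex.exp (-((n : ℂ) * (2 * π : ℝ) * Complex.I)) = 1 := by
    rw [Complex.exp_eq_one_iff]
    exact ⟨-n, by push_cast; ring⟩
  simp only [hper, he, Complex.ofReal_zero, mul_zero, zero_mul, neg_zero, Complex.exp_zero,
    sub_self] at h
  exact sub_eq_zero.1 h

/-! ### The inequality for a single frequency -/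

theorem nat_mul_sinh_le {x : ℝ} (hx : 0 ≤ x) (m : ℕ) : m * sinh x ≤ sinh (m * x) := by
  induction m with
  | zero => simp
  | succ m ih =>
    push_cast
    rw [add_mul, add_mul, one_mul, one_mul, sinh_add]
    have h1 := sinh_nonneg_iff.2 hx
    have h2 : 0 ≤ sinh (m * x) := sinh_nonneg_iff.2 (by positivity)
    nlinarith [one_le_cosh x, one_le_cosh (m * x)]

/-- Equality holds for `m = 1`. The addition formulas reduce the case `m + 1` to `cosh x * sinh (m
x) ≤ m * sinh x * cosh (m x)`, which is weaker than the case `m` because `1 + m sinh² x ≥ cosh² x`.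
-/
theorem one_add_nat_mul_sq_sinh_mul_sinh_le {x : ℝ} (hx : 0 ≤ x) {m : ℕ} (hm : 1 ≤ m) :
    (1 + m * sinh x ^ 2) * sinh (m * x) ≤ m * sinh x * cosh x * cosh (m * x) := by
  have hc := cosh_sq x
  induction m, hm using Nat.le_induction with
  | base =>
    simp only [Nat.cast_one, one_mul]
    rw [mul_assoc, ← sq, hc]
    exact le_of_eq (by ring)
  | succ m hm ih =>
    push_cast
    rw [add_mul (m : ℝ) 1 x, one_mul, sinh_add, cosh_add]
    have h1 := one_le_cosh x
    have h2 : 0 ≤ sinh (m * x) := sinh_nonneg_iff.2 (by positivity)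
    have hm' : (1 : ℝ) ≤ m := by exact_mod_cast hm
    have h3 : cosh x * (cosh x * sinh (m * x)) ≤ cosh x * (m * sinh x * cosh (m * x)) := by
      calc cosh x * (cosh x * sinh (m * x)) = (1 + sinh x ^ 2) * sinh (m * x) := by
            rw [← mul_assoc, ← sq, hc, add_comm]
        _ ≤ (1 + m * sinh x ^ 2) * sinh (m * x) := by
            gcongr
            nlinarith [sq_nonneg (sinh x)]
        _ ≤ _ := ih.trans_eq (by ring)
    have h4 := le_of_mul_le_mul_left h3 (by linarith)
    have e : (m + 1) * sinh x * cosh x * (cosh (m * x) * cosh x + sinh (m * x) * sinh x) -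
        (1 + (m + 1) * sinh x ^ 2) * (sinh (m * x) * cosh x + cosh (m * x) * sinh x) =
        m * sinh x * cosh (m * x) - cosh x * sinh (m * x) +
        ((m + 1) * sinh x * cosh (m * x)) * (cosh x ^ 2 - (sinh x ^ 2 + 1)) := by ring
    rw [hc, sub_self, mul_zero, add_zero] at e
    linarith

/-- The mode of frequency `m` with data `α = f(0)`, `β = f'(0)` for `f'' = m² f`. -/
theorem single_mode_ineq {x : ℝ} (hx : 0 < x) {m : ℕ} (hm : 1 ≤ m) (α β : ℂ) :
    (1 + m * sinh x ^ 2) * ‖α‖ ^ 2 ≤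
      ‖cosh (m * x) * α + sinh (m * x) / m * β‖ ^ 2 -
        2 * (sinh x * cosh x) * (conj α * β).re := by
  have hm' : (1 : ℝ) ≤ m := by exact_mod_cast hm
  have hs := sinh_pos_iff.2 hx
  have hc := one_le_cosh x
  have hS : 0 < sinh (m * x) := sinh_pos_iff.2 (by positivity)
  set S := sinh (m * x) with hSd
  set C := cosh (m * x) with hCd
  set s := sinh x
  set c := cosh x
  -- With `w = (S / m) β`, this factor turns `s c Re (conj α · β)` into `μ Re (conj α · w)`, so the
  -- square in `w` can be completed.
  set μ := s * c * m / S with hμ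
  have h1 : μ ^ 2 ≤ c ^ 2 := by
    have : μ ≤ c := by
      rw [hμ, div_le_iff₀ hS]
      nlinarith [nat_mul_sinh_le hx.le m]
    exact pow_le_pow_left₀ (by positivity) this 2
  have h2 : 1 + m * s ^ 2 ≤ C * μ := by
    rw [hμ, mul_div_assoc', le_div_iff₀ hS]
    linarith [one_add_nat_mul_sq_sinh_mul_sinh_le hx.le hm]
  have h3 : c ^ 2 = s ^ 2 + 1 := cosh_sq x
  -- The right side is at least `2 (1 + m s²) - (1 + s²)`, and `m ≥ 1`.
  have h4 : 1 + m * s ^ 2 ≤ 2 * C * μ - μ ^ 2 := by nlinarith [sq_nonneg s]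
  have hw : s * c * (conj α * β).re = μ * (conj α * (S / m * β)).re := by
    rw [show conj α * ((S : ℂ) / m * β) = ((S / m : ℝ) : ℂ) * (conj α * β) by push_cast; ring,
      Complex.re_ofReal_mul, hμ]
    field_simp
  rw [mul_assoc 2, hw]
  generalize (S : ℂ) / m * β = w
  have e : ‖C * α + w‖ ^ 2 - 2 * (μ * (conj α * w).re) =
      ‖w + ((C - μ : ℝ) : ℂ) * α‖ ^ 2 + (2 * C * μ - μ ^ 2) * ‖α‖ ^ 2 := by
    simp only [Complex.sq_norm, Complex.normSq_apply, Complex.mul_re, Complex.mul_im,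
      Complex.conj_re, Complex.conj_im, Complex.add_re, Complex.add_im, Complex.ofReal_re,
      Complex.ofReal_im]
    ring
  rw [e]
  nlinarith [sq_nonneg ‖w + ((C - μ : ℝ) : ℂ) * α‖, sq_nonneg ‖α‖]

/-- Solutions of `f'' = n² f`. -/
theorem eq_cosh_sinh_of_deriv_deriv {I : Set ℝ} (hI : IsOpen I) (hIc : IsPreconnected I)
    {f f' : ℝ → ℂ} {n : ℝ} (hn : n ≠ 0)
    (hf : ∀ t ∈ I, HasDerivAt f (f' t) t) (hf' : ∀ t ∈ I, HasDerivAt f' (n ^ 2 * f t) t)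
    {t₀ t : ℝ} (ht₀ : t₀ ∈ I) (ht : t ∈ I) :
    f t = cosh (n * (t - t₀)) * f t₀ + sinh (n * (t - t₀)) / n * f' t₀ := by
  -- For `k = ±n` the combination `f' + k f` satisfies the first-order equation `g' = k g`; the
  -- difference of the two recovers `f`.
  have key : ∀ k : ℝ, k ^ 2 = n ^ 2 →
      (f' t + k * f t) = Complex.exp (k * (t - t₀)) * (f' t₀ + k * f t₀) := by
    intro k hk
    have hk' : (k : ℂ) ^ 2 = (n : ℂ) ^ 2 := by exact_mod_cast hk
    have hd : ∀ x ∈ I, HasDerivAt (fun x : ℝ => Complex.exp (-(k * x)) * (f' x + k * f x)) 0 x := by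
      intro x hx
      have h1 : HasDerivAt (fun x : ℝ => -((k : ℂ) * x)) (-(k * 1)) x :=
        (((hasDerivAt_id (x : ℂ)).comp_ofReal).const_mul (k : ℂ)).neg
      refine (h1.cexp.mul ((hf' x hx).add ((hf x hx).const_mul (k : ℂ)))).congr_deriv ?_
      rw [← hk', Pi.add_apply]
      ring
    have hconst := hI.is_const_of_deriv_eq_zero hIc
      (fun x hx => (hd x hx).differentiableAt.differentiableWithinAt)
      (fun x hx => (hd x hx).deriv) ht ht₀
    have e : Complex.exp (k * (t - t₀)) = Complex.exp (k * t) * Complex.exp (-(k * t₀)) := by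
      rw [← Complex.exp_add]; ring_nf
    rw [e, mul_assoc, ← hconst, ← mul_assoc, ← Complex.exp_add]
    simp
  have h1 := key n rfl
  have h2 := key (-n) (by ring)
  have hn' : (n : ℂ) ≠ 0 := by exact_mod_cast hn
  push_cast at h1 h2 ⊢
  rw [Complex.cosh, Complex.sinh, ← neg_mul]
  generalize Complex.exp (-(n : ℂ) * (t - t₀)) = e₂ at h2 ⊢
  field_simp
  linear_combination (h1 - h2)

/-! ### Harmonic functions on a strip, periodic in the second variable -/

/-- `G` is a harmonic function on the strip `(0, ℓ) × ℝ`, of period `2π` in the second variable,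
with the given partial derivatives. -/
structure IsPeriodicHarmonic (ℓ : ℝ) (G Gt Gs Gtt Gts Gss : ℝ → ℝ → ℂ) : Prop where
  cont : ContinuousOn (fun p : ℝ × ℝ => G p.1 p.2) (Ioo 0 ℓ ×ˢ univ)
  cont_t : ContinuousOn (fun p : ℝ × ℝ => Gt p.1 p.2) (Ioo 0 ℓ ×ˢ univ)
  cont_s : ContinuousOn (fun p : ℝ × ℝ => Gs p.1 p.2) (Ioo 0 ℓ ×ˢ univ)
  cont_tt : ContinuousOn (fun p : ℝ × ℝ => Gtt p.1 p.2) (Ioo 0 ℓ ×ˢ univ)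
  cont_ts : ContinuousOn (fun p : ℝ × ℝ => Gts p.1 p.2) (Ioo 0 ℓ ×ˢ univ)
  cont_ss : ContinuousOn (fun p : ℝ × ℝ => Gss p.1 p.2) (Ioo 0 ℓ ×ˢ univ)
  deriv_t : ∀ t ∈ Ioo 0 ℓ, ∀ s, HasDerivAt (fun t => G t s) (Gt t s) t
  deriv_s : ∀ t ∈ Ioo 0 ℓ, ∀ s, HasDerivAt (fun s => G t s) (Gs t s) s
  deriv_tt : ∀ t ∈ Ioo 0 ℓ, ∀ s, HasDerivAt (fun t => Gt t s) (Gtt t s) t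
  deriv_ts : ∀ t ∈ Ioo 0 ℓ, ∀ s, HasDerivAt (fun t => Gs t s) (Gts t s) t
  deriv_st : ∀ t ∈ Ioo 0 ℓ, ∀ s, HasDerivAt (fun s => Gt t s) (Gts t s) s
  deriv_ss : ∀ t ∈ Ioo 0 ℓ, ∀ s, HasDerivAt (fun s => Gs t s) (Gss t s) s
  periodic : ∀ t, Function.Periodic (G t) (2 * π)
  periodic_t : ∀ t, Function.Periodic (Gt t) (2 * π)
  periodic_s : ∀ t, Function.Periodic (Gs t) (2 * π)
  laplace : ∀ t ∈ Ioo 0 ℓ, ∀ s, Gtt t s + Gss t s = 0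

theorem continuous_slice {E : Type*} [TopologicalSpace E] {I : Set ℝ}
    {H : ℝ → ℝ → E} (hH : ContinuousOn (fun p : ℝ × ℝ => H p.1 p.2) (I ×ˢ univ)) {t : ℝ}
    (ht : t ∈ I) : Continuous (H t) :=
  hH.comp_continuous (f := fun s => (t, s)) (by fun_prop) (fun s => ⟨ht, mem_univ s⟩)

theorem hasDerivAt_conj_mul {u v : ℝ → ℂ} {u' v' : ℂ} {x : ℝ} (hu : HasDerivAt u u' x)
    (hv : HasDerivAt v v' x) :
    HasDerivAt (fun x => conj (u x) * v x) (conj u' * v x + conj (u x) * v') x :=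
  (Complex.conjCLE.hasFDerivAt.comp_hasDerivAt x hu).mul hv

theorem hasDerivAt_re {u : ℝ → ℂ} {u' : ℂ} {x : ℝ} (hu : HasDerivAt u u' x) :
    HasDerivAt (fun x => (u x).re) u'.re x :=
  Complex.reCLM.hasFDerivAt.comp_hasDerivAt x hu

theorem hasDerivAt_im {u : ℝ → ℂ} {u' : ℂ} {x : ℝ} (hu : HasDerivAt u u' x) :
    HasDerivAt (fun x => (u x).im) u'.im x :=
  Complex.imCLM.hasFDerivAt.comp_hasDerivAt x hu

/-- The squared `L²` norm of `G` on circles. -/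
noncomputable def energy (G : ℝ → ℝ → ℂ) (t : ℝ) : ℝ := ∫ s in (0 : ℝ)..2 * π, ‖G t s‖ ^ 2

/-- The real part of the `L²` inner product on circles. -/
noncomputable def circleInner (G H : ℝ → ℝ → ℂ) (t : ℝ) : ℝ :=
  ∫ s in (0 : ℝ)..2 * π, (conj (G t s) * H t s).re

/-- Twice the area enclosed by the image of a circle. -/
noncomputable def sweptArea (G Gs : ℝ → ℝ → ℂ) (t : ℝ) : ℝ :=
  ∫ s in (0 : ℝ)..2 * π, (conj (G t s) * Gs t s).im

/-! ### Fourier modes, convexity and growth of the energy. -/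

namespace IsPeriodicHarmonic

variable {ℓ : ℝ} {G Gt Gs Gtt Gts Gss : ℝ → ℝ → ℂ}
  (hG : IsPeriodicHarmonic ℓ G Gt Gs Gtt Gts Gss)

theorem hasDerivAt_fourierInt_aux {F F' : ℝ → ℝ → ℂ}
    (hF : ContinuousOn (fun p : ℝ × ℝ => F p.1 p.2) (Ioo 0 ℓ ×ˢ univ))
    (hF' : ContinuousOn (fun p : ℝ × ℝ => F' p.1 p.2) (Ioo 0 ℓ ×ˢ univ))
    (hd : ∀ t ∈ Ioo 0 ℓ, ∀ s, HasDerivAt (fun t => F t s) (F' t s) t) {t : ℝ}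
    (ht : t ∈ Ioo 0 ℓ) (n : ℤ) :
    HasDerivAt (fun t => fourierInt (F t) n) (fourierInt (F' t) n) t := by
  have he : Continuous fun p : ℝ × ℝ => Complex.exp (-(n * p.2 * Complex.I)) := by fun_prop
  exact hasDerivAt_intervalIntegral_of_continuousOn isOpen_Ioo
    (F := fun t θ => Complex.exp (-(n * θ * Complex.I)) * F t θ)
    (F' := fun t θ => Complex.exp (-(n * θ * Complex.I)) * F' t θ)
    (he.continuousOn.mul hF) (he.continuousOn.mul hF') (fun x hx s => (hd x hx s).const_mul _) ht

include hG

theorem hasDerivAt_fourierInt {t : ℝ} (ht : t ∈ Ioo 0 ℓ) (n : ℤ) :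
    HasDerivAt (fun t => fourierInt (G t) n) (fourierInt (Gt t) n) t :=
  hasDerivAt_fourierInt_aux hG.cont hG.cont_t hG.deriv_t ht n

theorem fourierInt_s {t : ℝ} (ht : t ∈ Ioo 0 ℓ) (n : ℤ) :
    fourierInt (Gs t) n = n * Complex.I * fourierInt (G t) n :=
  fourierInt_deriv (hG.deriv_s t ht) (continuous_slice hG.cont_s ht)
    (by simpa using hG.periodic t 0) n

theorem hasDerivAt_fourierInt_t {t : ℝ} (ht : t ∈ Ioo 0 ℓ) (n : ℤ) :
    HasDerivAt (fun t => fourierInt (Gt t) n) ((n : ℂ) ^ 2 * fourierInt (G t) n) t := by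
  refine (hasDerivAt_fourierInt_aux hG.cont_t hG.cont_tt hG.deriv_tt ht n).congr_deriv ?_
  have h1 : Gtt t = fun s => (-1) * Gss t s := by
    funext s
    linear_combination hG.laplace t ht s
  rw [h1, fourierInt_const_mul, fourierInt_deriv (hG.deriv_ss t ht)
    (continuous_slice hG.cont_ss ht) (by simpa using hG.periodic_s t 0) n, hG.fourierInt_s ht n]
  linear_combination (-(n : ℂ) ^ 2 * fourierInt (G t) n) * Complex.I_sq

theorem hasDerivAt_energy {t : ℝ} (ht : t ∈ Ioo 0 ℓ) :
    HasDerivAt (energy G) (2 * circleInner G Gt t) t := by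
  have h := hasDerivAt_intervalIntegral_of_continuousOn (a := 0) (b := 2 * π) isOpen_Ioo
    (F := fun t s => ‖G t s‖ ^ 2) (F' := fun t s => 2 * (conj (G t s) * Gt t s).re)
    (hG.cont.norm.pow 2) (continuousOn_const.mul (Complex.continuous_re.comp_continuousOn
      ((Complex.continuous_conj.comp_continuousOn hG.cont).mul hG.cont_t)))
    (fun x hx s => by
      refine ((hG.deriv_t x hx s).norm_sq).congr_deriv ?_
      rw [Complex.inner]
      simp [mul_comm]) ht
  refine h.congr_deriv ?_
  rw [circleInner, intervalIntegral.integral_const_mul]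

theorem hasDerivAt_circleInner {t : ℝ} (ht : t ∈ Ioo 0 ℓ) :
    HasDerivAt (circleInner G Gt) (energy Gt t + energy Gs t) t := by
  have cre : ∀ {A B : ℝ → ℝ → ℂ},
      ContinuousOn (fun p : ℝ × ℝ => A p.1 p.2) (Ioo 0 ℓ ×ˢ univ) →
      ContinuousOn (fun p : ℝ × ℝ => B p.1 p.2) (Ioo 0 ℓ ×ˢ univ) →
      ContinuousOn (fun p : ℝ × ℝ => (conj (A p.1 p.2) * B p.1 p.2).re) (Ioo 0 ℓ ×ˢ univ) :=
    fun hA hB => Complex.continuous_re.comp_continuousOn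
      ((Complex.continuous_conj.comp_continuousOn hA).mul hB)
  have sq : ∀ z : ℂ, (conj z * z).re = ‖z‖ ^ 2 := fun z => by
    simp [Complex.sq_norm, Complex.normSq_apply]
  have h := hasDerivAt_intervalIntegral_of_continuousOn (a := 0) (b := 2 * π) isOpen_Ioo
    (F := fun t s => (conj (G t s) * Gt t s).re)
    (F' := fun t s => (conj (Gt t s) * Gt t s).re + (conj (G t s) * Gtt t s).re)
    (cre hG.cont hG.cont_t) ((cre hG.cont_t hG.cont_t).add (cre hG.cont hG.cont_tt))
    (fun x hx s => hasDerivAt_re (hasDerivAt_conj_mul (hG.deriv_t x hx s) (hG.deriv_tt x hx s)))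
    ht
  refine h.congr_deriv ?_
  have c0 := continuous_slice hG.cont ht
  have c1 := continuous_slice hG.cont_t ht
  have c2 := continuous_slice hG.cont_s ht
  have c3 := continuous_slice hG.cont_tt ht
  have c4 := continuous_slice hG.cont_ss ht
  -- Integration by parts over a period, with `Gtt = -Gss`, trades the term in `Gtt` for `|Gs|²`.
  have hs : ∀ s, HasDerivAt (fun s => (conj (G t s) * Gs t s).re)
      (‖Gs t s‖ ^ 2 - (conj (G t s) * Gtt t s).re) s := fun s => by
    refine (hasDerivAt_re
      (hasDerivAt_conj_mul (hG.deriv_s t ht s) (hG.deriv_ss t ht s))).congr_deriv ?_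
    rw [eq_neg_of_add_eq_zero_left (hG.laplace t ht s), ← sq, Complex.add_re, mul_neg,
      Complex.neg_re, sub_neg_eq_add]
  have hz := intervalIntegral.integral_eq_sub_of_hasDerivAt (a := 0) (b := 2 * π)
    (fun s _ => hs s) (Continuous.intervalIntegrable (by fun_prop) _ _)
  have p0 : G t (2 * π) = G t 0 := by simpa using hG.periodic t 0
  have p1 : Gs t (2 * π) = Gs t 0 := by simpa using hG.periodic_s t 0
  rw [p0, p1, sub_self, intervalIntegral.integral_sub
    (Continuous.intervalIntegrable (by fun_prop) _ _)
    (Continuous.intervalIntegrable (by fun_prop) _ _)] at hz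
  rw [intervalIntegral.integral_add (Continuous.intervalIntegrable (by fun_prop) _ _)
    (Continuous.intervalIntegrable (by fun_prop) _ _), energy, energy]
  simp only [sq]
  linarith

theorem continuousOn_energy : ContinuousOn (energy G) (Ioo 0 ℓ) := fun _ ht =>
  (hG.hasDerivAt_energy ht).continuousAt.continuousWithinAt

/-- If the energy is minimal at the left end of the strip, then it is nondecreasing. -/
theorem circleInner_nonneg {c : ℝ} (hc : ∀ t ∈ Ioo 0 ℓ, c ≤ energy G t)
    (hlim : Tendsto (energy G) (𝓝[>] 0) (𝓝 c)) {t : ℝ} (ht : t ∈ Ioo 0 ℓ) :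
    0 ≤ circleInner G Gt t := by
  -- The slope is nondecreasing, so a negative value at `t` stays negative on `(0, t]`; the energy
  -- then drops strictly below its limit `c`.
  by_contra! hneg
  have hmono : MonotoneOn (circleInner G Gt) (Ioo 0 ℓ) := by
    refine monotoneOn_of_deriv_nonneg (convex_Ioo 0 ℓ)
      (fun x hx => (hG.hasDerivAt_circleInner hx).continuousAt.continuousWithinAt)
      (fun x hx => ?_) (fun x hx => ?_) <;> rw [interior_Ioo] at hx
    · exact (hG.hasDerivAt_circleInner hx).differentiableAt.differentiableWithinAt
    · rw [(hG.hasDerivAt_circleInner hx).deriv]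
      exact add_nonneg (intervalIntegral.integral_nonneg two_pi_pos.le fun _ _ => by positivity)
        (intervalIntegral.integral_nonneg two_pi_pos.le fun _ _ => by positivity)
  have hanti : StrictAntiOn (energy G) (Ioc 0 t) := by
    refine strictAntiOn_of_deriv_neg (convex_Ioc 0 t)
      (hG.continuousOn_energy.mono fun x hx => ⟨hx.1, hx.2.trans_lt ht.2⟩) (fun x hx => ?_)
    rw [interior_Ioc] at hx
    have hx' : x ∈ Ioo 0 ℓ := ⟨hx.1, hx.2.trans ht.2⟩
    rw [(hG.hasDerivAt_energy hx').deriv]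
    linarith [hmono hx' ht hx.2.le]
  have h2 : t / 2 ∈ Ioc 0 t := ⟨by linarith [ht.1], by linarith [ht.1]⟩
  have h1 : energy G t < energy G (t / 2) := hanti h2 ⟨ht.1, le_rfl⟩ (by linarith [ht.1])
  have h3 : energy G (t / 2) ≤ c := by
    refine ge_of_tendsto hlim ?_
    filter_upwards [Ioo_mem_nhdsGT h2.1] with x hx
    exact (hanti ⟨hx.1, by linarith [hx.2, h2.2]⟩ h2 hx.2).le
  linarith [hc t ht]

theorem monotoneOn_energy {c : ℝ} (hc : ∀ t ∈ Ioo 0 ℓ, c ≤ energy G t)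
    (hlim : Tendsto (energy G) (𝓝[>] 0) (𝓝 c)) : MonotoneOn (energy G) (Ioo 0 ℓ) := by
  refine monotoneOn_of_deriv_nonneg (convex_Ioo 0 ℓ) hG.continuousOn_energy
    (fun x hx => ?_) (fun x hx => ?_) <;> rw [interior_Ioo] at hx
  · exact (hG.hasDerivAt_energy hx).differentiableAt.differentiableWithinAt
  · rw [(hG.hasDerivAt_energy hx).deriv]
    linarith [hG.circleInner_nonneg hc hlim hx]

theorem fourierInt_ineq {ε T : ℝ} (hε : ε ∈ Ioo 0 ℓ) (hT : T ∈ Ioo 0 ℓ) (hεT : ε < T) {n : ℤ}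
    (hn : n ≠ 0) :
    (1 + |(n : ℝ)| * sinh (T - ε) ^ 2) * ‖fourierInt (G ε) n‖ ^ 2 ≤
      ‖fourierInt (G T) n‖ ^ 2 - 2 * (sinh (T - ε) * cosh (T - ε)) *
        (conj (fourierInt (G ε) n) * fourierInt (Gt ε) n).re := by
  have hm : 1 ≤ n.natAbs := Int.one_le_abs hn |> fun h => by omega
  have hm0 : ((n.natAbs : ℕ) : ℝ) ≠ 0 := by positivity
  have hsq : (((n.natAbs : ℕ) : ℝ) : ℂ) ^ 2 = (n : ℂ) ^ 2 := by
    have h : (((n.natAbs : ℕ) : ℤ) : ℂ) ^ 2 = (n : ℂ) ^ 2 := by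
      exact_mod_cast congrArg (Int.cast : ℤ → ℂ) (Int.natAbs_sq n)
    simpa only [Int.cast_natCast, Complex.ofReal_natCast] using h
  have h := eq_cosh_sinh_of_deriv_deriv isOpen_Ioo isPreconnected_Ioo hm0
    (fun t ht => hG.hasDerivAt_fourierInt ht n)
    (fun t ht => by rw [hsq]; exact hG.hasDerivAt_fourierInt_t ht n) hε hT
  have habs : |(n : ℝ)| = ((n.natAbs : ℕ) : ℝ) := by
    rw [Nat.cast_natAbs]; push_cast; rfl
  rw [h, habs]
  exact single_mode_ineq (by linarith) hm _ _

theorem hasSum_energy {t : ℝ} (ht : t ∈ Ioo 0 ℓ) :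
    HasSum (fun n => ‖fourierInt (G t) n‖ ^ 2) (2 * π * energy G t) :=
  hasSum_sq_fourierInt (continuous_slice hG.cont ht)

theorem hasSum_circleInner {t : ℝ} (ht : t ∈ Ioo 0 ℓ) :
    HasSum (fun n => (conj (fourierInt (G t) n) * fourierInt (Gt t) n).re)
      (2 * π * circleInner G Gt t) :=
  hasSum_inner_fourierInt (continuous_slice hG.cont ht) (continuous_slice hG.cont_t ht)

/-- Parseval for `G` and `-i Gs`: the coefficients of `Gs` are `i n fₙ`, so the weight is the signed
frequency `n`. -/
theorem hasSum_sweptArea {t : ℝ} (ht : t ∈ Ioo 0 ℓ) :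
    HasSum (fun n : ℤ => n * ‖fourierInt (G t) n‖ ^ 2) (2 * π * sweptArea G Gs t) := by
  have h := hasSum_inner_fourierInt (u := G t) (v := fun s => -Complex.I * Gs t s)
    (continuous_slice hG.cont ht) (continuous_const.mul (continuous_slice hG.cont_s ht))
  convert! h using 1
  · funext n
    rw [fourierInt_const_mul, hG.fourierInt_s ht]
    simp only [Complex.sq_norm, Complex.normSq_apply, Complex.mul_re, Complex.mul_im,
      Complex.conj_re, Complex.conj_im, Complex.neg_re, Complex.neg_im, Complex.I_re,
      Complex.I_im, Complex.intCast_re, Complex.intCast_im]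
    ring
  · simp only [sweptArea]
    congr 2
    funext s
    simp only [Complex.mul_re, Complex.mul_im,
      Complex.conj_re, Complex.conj_im, Complex.neg_re, Complex.neg_im, Complex.I_re,
      Complex.I_im]
    ring

/-- Growth of the energy when the zeroth Fourier coefficient is constant. -/
theorem energy_add_sweptArea_le {ε T : ℝ} (hε : ε ∈ Ioo 0 ℓ) (hT : T ∈ Ioo 0 ℓ) (hεT : ε < T)
    (h0 : fourierInt (Gt ε) 0 = 0) (h0T : fourierInt (G T) 0 = fourierInt (G ε) 0) :
    energy G ε + sinh (T - ε) ^ 2 * sweptArea G Gs ε ≤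
      energy G T - 2 * (sinh (T - ε) * cosh (T - ε)) * circleInner G Gt ε := by
  have hL := (hG.hasSum_energy hε).add ((hG.hasSum_sweptArea hε).mul_left (sinh (T - ε) ^ 2))
  have hR := (hG.hasSum_energy hT).sub
    ((hG.hasSum_circleInner hε).mul_left (2 * (sinh (T - ε) * cosh (T - ε))))
  have h := hasSum_le (fun n => ?_) hL hR
  · refine le_of_mul_le_mul_left ?_ two_pi_pos
    linarith
  · rcases eq_or_ne n 0 with rfl | hn
    · simp [h0, h0T]
    · refine le_trans ?_ (hG.fourierInt_ineq hε hT hεT hn)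
      -- The area carries `n`, the mode inequality `|n|`; negative frequencies only help.
      have : (n : ℝ) * (sinh (T - ε) ^ 2 * ‖fourierInt (G ε) n‖ ^ 2) ≤
          |(n : ℝ)| * (sinh (T - ε) ^ 2 * ‖fourierInt (G ε) n‖ ^ 2) := by
        gcongr
        exact le_abs_self _
      linarith

/-- Growth of the energy, up to an error coming from the zeroth Fourier coefficient. -/
theorem cosh_sq_mul_energy_le {ε T : ℝ} (hε : ε ∈ Ioo 0 ℓ) (hT : T ∈ Ioo 0 ℓ) (hεT : ε < T) :
    2 * π * (cosh (T - ε) ^ 2 * energy G ε) ≤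
      2 * π * (energy G T - 2 * (sinh (T - ε) * cosh (T - ε)) * circleInner G Gt ε) +
      (2 * (sinh (T - ε) * cosh (T - ε)) *
          (conj (fourierInt (G ε) 0) * fourierInt (Gt ε) 0).re +
        cosh (T - ε) ^ 2 * ‖fourierInt (G ε) 0‖ ^ 2) := by
  have hL := (hG.hasSum_energy hε).mul_left (cosh (T - ε) ^ 2)
  -- The mode inequality is not available at `n = 0`; a series supported there absorbs the defect.
  have hR := ((hG.hasSum_energy hT).sub
    ((hG.hasSum_circleInner hε).mul_left (2 * (sinh (T - ε) * cosh (T - ε))))).add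
    (hasSum_ite_eq (0 : ℤ) (2 * (sinh (T - ε) * cosh (T - ε)) *
          (conj (fourierInt (G ε) 0) * fourierInt (Gt ε) 0).re +
        cosh (T - ε) ^ 2 * ‖fourierInt (G ε) 0‖ ^ 2))
  have h := hasSum_le (fun n => ?_) hL hR
  · linarith
  · rcases eq_or_ne n 0 with rfl | hn
    · rw [if_pos rfl]
      nlinarith [sq_nonneg ‖fourierInt (G T) 0‖]
    · rw [if_neg hn, add_zero]
      refine le_trans ?_ (hG.fourierInt_ineq hε hT hεT hn)
      have h1 : (1 : ℝ) ≤ |(n : ℝ)| := by exact_mod_cast Int.one_le_abs hn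
      rw [cosh_sq, add_comm]
      gcongr
      nlinarith [sq_nonneg (sinh (T - ε))]

/-- At `n = 0` the equation is `f'' = 0`: the zeroth mode is affine in `t`. -/
theorem fourierInt_t_zero_const {t t' : ℝ} (ht : t ∈ Ioo 0 ℓ) (ht' : t' ∈ Ioo 0 ℓ) :
    fourierInt (Gt t) 0 = fourierInt (Gt t') 0 := by
  have hd : ∀ x ∈ Ioo 0 ℓ, HasDerivAt (fun t => fourierInt (Gt t) 0) 0 x := fun x hx =>
    (hG.hasDerivAt_fourierInt_t hx 0).congr_deriv (by simp)
  exact isOpen_Ioo.is_const_of_deriv_eq_zero isPreconnected_Ioo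
    (fun x hx => (hd x hx).differentiableAt.differentiableWithinAt)
    (fun x hx => (hd x hx).deriv) ht ht'

theorem fourierInt_zero_const {t₀ : ℝ} (ht₀ : t₀ ∈ Ioo 0 ℓ) (h0 : fourierInt (Gt t₀) 0 = 0)
    {t t' : ℝ} (ht : t ∈ Ioo 0 ℓ) (ht' : t' ∈ Ioo 0 ℓ) :
    fourierInt (G t) 0 = fourierInt (G t') 0 := by
  have hd : ∀ x ∈ Ioo 0 ℓ, HasDerivAt (fun t => fourierInt (G t) 0) 0 x := fun x hx =>
    (hG.hasDerivAt_fourierInt hx 0).congr_deriv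
      ((hG.fourierInt_t_zero_const hx ht₀).trans h0)
  exact isOpen_Ioo.is_const_of_deriv_eq_zero isPreconnected_Ioo
    (fun x hx => (hd x hx).differentiableAt.differentiableWithinAt)
    (fun x hx => (hd x hx).deriv) ht ht'

/-- The energy bound when the normal derivative has vanishing averages. -/
theorem cosh_sq_le_energy_of_normal {c : ℝ} (hc : ∀ t ∈ Ioo 0 ℓ, c ≤ energy G t)
    (hlim : Tendsto (energy G) (𝓝[>] 0) (𝓝 c)) (hW : ∀ t ∈ Ioo 0 ℓ, c ≤ sweptArea G Gs t)
    {t₀ : ℝ} (ht₀ : t₀ ∈ Ioo 0 ℓ) (h0 : fourierInt (Gt t₀) 0 = 0) {T : ℝ} (hT : T ∈ Ioo 0 ℓ) :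
    c * cosh T ^ 2 ≤ energy G T := by
  have hl : Tendsto (fun ε => c * cosh (T - ε) ^ 2) (𝓝[>] 0) (𝓝 (c * cosh T ^ 2)) := by
    have : Continuous fun ε => c * cosh (T - ε) ^ 2 := by fun_prop
    simpa using (this.tendsto 0).mono_left nhdsWithin_le_nhds
  refine le_of_tendsto hl ?_
  filter_upwards [Ioo_mem_nhdsGT hT.1] with ε hε
  have hε' : ε ∈ Ioo 0 ℓ := ⟨hε.1, hε.2.trans hT.2⟩
  have h1 := hG.energy_add_sweptArea_le hε' hT hε.2
    ((hG.fourierInt_t_zero_const hε' ht₀).trans h0) (hG.fourierInt_zero_const ht₀ h0 hT hε')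
  have h2 := hG.circleInner_nonneg hc hlim hε'
  have h3 : 0 ≤ sinh (T - ε) := sinh_nonneg_iff.2 (by linarith [hε.2])
  have h4 := cosh_pos (T - ε)
  have h5 : 0 ≤ 2 * (sinh (T - ε) * cosh (T - ε)) * circleInner G Gt ε := by positivity
  have h6 := mul_le_mul_of_nonneg_left (hW ε hε') (sq_nonneg (sinh (T - ε)))
  rw [cosh_sq]
  linarith [hc ε hε']

/-- The energy bound when the averages tend to zero at the left end. -/
theorem cosh_sq_le_energy_of_average {c : ℝ} (hc : ∀ t ∈ Ioo 0 ℓ, c ≤ energy G t)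
    (hlim : Tendsto (energy G) (𝓝[>] 0) (𝓝 c))
    (h0 : Tendsto (fun t => fourierInt (G t) 0) (𝓝[>] 0) (𝓝 0)) {T : ℝ} (hT : T ∈ Ioo 0 ℓ) :
    c * cosh T ^ 2 ≤ energy G T := by
  have hl : Tendsto (fun ε => 2 * π * (c * cosh (T - ε) ^ 2)) (𝓝[>] 0)
      (𝓝 (2 * π * (c * cosh T ^ 2))) := by
    have : Continuous fun ε => 2 * π * (c * cosh (T - ε) ^ 2) := by fun_prop
    simpa using (this.tendsto 0).mono_left nhdsWithin_le_nhds
  have ht' : Tendsto (fun ε : ℝ => T - ε) (𝓝[>] 0) (𝓝 T) := by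
    have : Continuous fun ε : ℝ => T - ε := by fun_prop
    simpa using (this.tendsto 0).mono_left nhdsWithin_le_nhds
  have hs := (continuous_sinh.tendsto T).comp ht'
  have hch := (continuous_cosh.tendsto T).comp ht'
  -- The slope of the zeroth mode is constant, so it may be evaluated at `T`; the error then
  -- vanishes with `fourierInt (G ε) 0`.
  have hr : Tendsto (fun ε => 2 * π * energy G T +
      (2 * (sinh (T - ε) * cosh (T - ε)) *
          (conj (fourierInt (G ε) 0) * fourierInt (Gt T) 0).re +
        cosh (T - ε) ^ 2 * ‖fourierInt (G ε) 0‖ ^ 2)) (𝓝[>] 0) (𝓝 (2 * π * energy G T)) := by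
    have e1 := (Complex.continuous_re.tendsto _).comp
      (((Complex.continuous_conj.tendsto _).comp h0).mul_const (fourierInt (Gt T) 0))
    have := tendsto_const_nhds (x := 2 * π * energy G T) |>.add
      ((((hs.mul hch).const_mul 2).mul e1).add ((hch.pow 2).mul (h0.norm.pow 2)))
    simpa using this
  refine le_of_mul_le_mul_left (le_of_tendsto_of_tendsto hl hr ?_) two_pi_pos
  filter_upwards [Ioo_mem_nhdsGT hT.1] with ε hε
  have hε' : ε ∈ Ioo 0 ℓ := ⟨hε.1, hε.2.trans hT.2⟩
  have h1 := hG.cosh_sq_mul_energy_le hε' hT hε.2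
  have h2 := hG.circleInner_nonneg hc hlim hε'
  have h3 : 0 ≤ sinh (T - ε) := sinh_nonneg_iff.2 (by linarith [hε.2])
  have h4 := cosh_pos (T - ε)
  have h5 : 0 ≤ 2 * π * (2 * (sinh (T - ε) * cosh (T - ε)) * circleInner G Gt ε) := by
    positivity
  have h6 := mul_le_mul_of_nonneg_left
    (mul_le_mul_of_nonneg_left (hc ε hε') (sq_nonneg (cosh (T - ε)))) two_pi_pos.le
  rw [hG.fourierInt_t_zero_const hε' hT] at h1
  linarith

end IsPeriodicHarmonic

/-! ### Logarithmic derivatives of closed curves -/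

/-- The product `γ · exp (-∫ γ'/γ)` is constant, so closing up forces the exponential of the full
integral to be `1`. -/
theorem exists_int_integral_div_eq {γ γ' : ℝ → ℂ} (hγ : ∀ θ, HasDerivAt γ (γ' θ) θ)
    (hγ' : Continuous γ') (h0 : ∀ θ, γ θ ≠ 0) (hper : γ (2 * π) = γ 0) :
    ∃ n : ℤ, ∫ θ in (0 : ℝ)..2 * π, γ' θ / γ θ = n * (2 * π * Complex.I) := by
  have hc : Continuous γ := continuous_iff_continuousAt.2 fun θ => (hγ θ).continuousAt
  have hq : Continuous fun θ => γ' θ / γ θ := hγ'.div hc h0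
  have hd : ∀ θ, HasDerivAt (fun x => Complex.exp (-∫ θ in (0 : ℝ)..x, γ' θ / γ θ) * γ x) 0 θ := by
    intro θ
    have h1 := (intervalIntegral.integral_hasDerivAt_right (hq.intervalIntegrable 0 θ)
      (hq.stronglyMeasurableAtFilter _ _) hq.continuousAt).neg
    refine (h1.cexp.mul (hγ θ)).congr_deriv ?_
    rw [Pi.neg_apply]
    field_simp [h0 θ]
    ring
  have hconst := is_const_of_deriv_eq_zero (fun θ => (hd θ).differentiableAt)
    (fun θ => (hd θ).deriv) (2 * π) 0
  rw [intervalIntegral.integral_same, neg_zero, Complex.exp_zero, one_mul, hper] at hconst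
  have := mul_right_cancel₀ (h0 0) (hconst.trans (one_mul _).symm)
  rw [Complex.exp_neg, inv_eq_one, Complex.exp_eq_one_iff] at this
  exact this

/-- The principal logarithm is a single-valued primitive on the right half-plane. -/
theorem integral_div_eq_zero_of_re_pos {u u' : ℝ → ℂ} (hu : ∀ θ, HasDerivAt u (u' θ) θ)
    (hu' : Continuous u') (hre : ∀ θ, 0 < (u θ).re) (hper : u (2 * π) = u 0) :
    ∫ θ in (0 : ℝ)..2 * π, u' θ / u θ = 0 := by
  have hc : Continuous u := continuous_iff_continuousAt.2 fun θ => (hu θ).continuousAt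
  have hne : ∀ θ, u θ ≠ 0 := fun θ h => by simpa [h] using hre θ
  have h := intervalIntegral.integral_eq_sub_of_hasDerivAt (a := 0) (b := 2 * π)
    (fun θ _ => (hu θ).clog_real (Or.inl (hre θ)))
    ((hu'.div hc hne).intervalIntegrable _ _)
  simpa [hper] using h

theorem re_one_sub_pos {z : ℂ} (hz : ‖z‖ < 1) : 0 < (1 - z).re := by
  have := (Complex.abs_re_le_norm z).trans_lt hz
  simp only [Complex.sub_re, Complex.one_re]
  linarith [(abs_lt.1 this).2]

/-- A closed curve inside a disk about `0` does not wind around the points outside the disk. -/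
theorem integral_div_sub_eq_zero_of_norm_lt {γ γ' : ℝ → ℂ} (hγ : ∀ θ, HasDerivAt γ (γ' θ) θ)
    (hγ' : Continuous γ') (hper : γ (2 * π) = γ 0) {w : ℂ} (hw : ∀ θ, ‖γ θ‖ < ‖w‖) :
    ∫ θ in (0 : ℝ)..2 * π, γ' θ / (γ θ - w) = 0 := by
  have hw0 : w ≠ 0 := norm_pos_iff.1 ((norm_nonneg _).trans_lt (hw 0))
  -- This curve lies in the unit disk about `1`, and its logarithmic derivative is `γ' / (γ - w)`.
  have h := integral_div_eq_zero_of_re_pos (u := fun θ => 1 - γ θ / w) (u' := fun θ => -(γ' θ / w))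
    (fun θ => ((hγ θ).div_const w).const_sub 1) (by fun_prop)
    (fun θ => re_one_sub_pos (by
      rw [norm_div, div_lt_one (norm_pos_iff.2 hw0)]; exact hw θ)) (by simp only [hper])
  rw [← h]
  congr 1
  funext θ
  have h1 : γ θ - w ≠ 0 := sub_ne_zero.2 fun h => (hw θ).ne (by rw [h])
  have h2 : 1 - γ θ / w ≠ 0 := by
    rw [sub_ne_zero]
    intro h3
    rw [eq_div_iff hw0] at h3
    exact h1 (by rw [← h3]; ring)
  rw [div_eq_div_iff h1 h2]
  field_simp
  ring

/-- A closed curve outside a disk about `0` winds equally often around the points of the disk. -/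
theorem integral_div_sub_eq_of_norm_lt {γ γ' : ℝ → ℂ} (hγ : ∀ θ, HasDerivAt γ (γ' θ) θ)
    (hγ' : Continuous γ') (hper : γ (2 * π) = γ 0) {w : ℂ} (hw : ∀ θ, ‖w‖ < ‖γ θ‖) :
    ∫ θ in (0 : ℝ)..2 * π, γ' θ / (γ θ - w) = ∫ θ in (0 : ℝ)..2 * π, γ' θ / γ θ := by
  have hc : Continuous γ := continuous_iff_continuousAt.2 fun θ => (hγ θ).continuousAt
  have h0 : ∀ θ, γ θ ≠ 0 := fun θ => norm_pos_iff.1 ((norm_nonneg _).trans_lt (hw θ))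
  have h1 : ∀ θ, γ θ - w ≠ 0 := fun θ => sub_ne_zero.2 fun h => (hw θ).ne (by rw [h])
  -- Here the logarithmic derivative is `γ' / (γ - w) - γ' / γ`.
  have h := integral_div_eq_zero_of_re_pos (u := fun θ => 1 - w / γ θ)
    (u' := fun θ => w * γ' θ / γ θ ^ 2)
    (fun θ => by
      refine (((hγ θ).inv (h0 θ)).const_mul w |>.const_sub 1).congr_deriv ?_
      ring)
    (by have := fun θ => pow_ne_zero 2 (h0 θ); fun_prop (disch := assumption))
    (fun θ => re_one_sub_pos (by
      rw [norm_div, div_lt_one (norm_pos_iff.2 (h0 θ))]; exact hw θ)) (by simp only [hper])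
  rw [← sub_eq_zero, ← intervalIntegral.integral_sub
    (Continuous.intervalIntegrable (by fun_prop (disch := assumption)) _ _)
    (Continuous.intervalIntegrable (by fun_prop (disch := assumption)) _ _), ← h]
  congr 1
  funext θ
  have h2 : 1 - w / γ θ ≠ 0 := by
    rw [sub_ne_zero]
    intro h3
    rw [eq_div_iff (h0 θ), one_mul] at h3
    exact h1 θ (by rw [h3]; ring)
  have := h0 θ
  have := h1 θ
  have h3 : γ θ * (1 - w / γ θ) = γ θ - w := by field_simp
  field_simp
  rw [← h3]
  field_simp
  ring

/-! ### Cut-off functions -/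

theorem exists_forall_le_of_periodic {f : ℝ → ℝ} (hf : Continuous f)
    (hper : Function.Periodic f (2 * π)) : ∃ s₀, ∀ s, f s₀ ≤ f s := by
  obtain ⟨s₀, -, hs₀⟩ := (isCompact_Icc (a := (0 : ℝ)) (b := 2 * π)).exists_isMinOn
    (nonempty_Icc.2 two_pi_pos.le) hf.continuousOn
  refine ⟨s₀, fun s => ?_⟩
  obtain ⟨s', hs', h⟩ := hper.exists_mem_Ico₀ two_pi_pos s
  rw [h]
  exact hs₀ (Ico_subset_Icc_self hs')

/-- The circulation divides by `|G - a|²`, which vanishes when a curve meets `a`; a weight that is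
zero near the origin removes this singularity. -/
theorem contDiff_div_id_of_eq_zero {χ : ℝ → ℝ} (hχ : ContDiff ℝ 1 χ) {a : ℝ} (ha : 0 < a)
    (h0 : ∀ s ≤ a, χ s = 0) : ContDiff ℝ 1 (fun s => χ s / s) := by
  rw [contDiff_iff_contDiffAt]
  intro s
  rcases eq_or_ne s 0 with rfl | hs
  · refine (contDiffAt_const (c := (0 : ℝ))).congr_of_eventuallyEq ?_
    filter_upwards [Iio_mem_nhds ha] with s hs
    rw [h0 s (le_of_lt hs), zero_div]
  · exact hχ.contDiffAt.div contDiffAt_id hs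

theorem div_id_add_mul_deriv_div_id {χ : ℝ → ℝ} (hχ : ContDiff ℝ 1 χ) {a : ℝ} (ha : 0 < a)
    (h0 : ∀ s ≤ a, χ s = 0) (s : ℝ) :
    χ s / s + s * deriv (fun s => χ s / s) s = deriv χ s := by
  have hκ := ((contDiff_div_id_of_eq_zero hχ ha h0).differentiable one_ne_zero s).hasDerivAt
  have h1 := ((hasDerivAt_id s).mul hκ).deriv
  have h2 : (id * fun s => χ s / s) = χ := by
    funext s
    rcases eq_or_ne s 0 with rfl | hs
    · simp [h0 0 ha.le]
    · simp only [Pi.mul_apply, id]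
      field_simp
  rw [h2] at h1
  rw [h1]
  simp

/-- A smooth substitute for `max (s - 1) 0`: it vanishes up to `1 + δ` and equals `s - 1` from `1 +
2δ` on. -/
theorem monotone_sub_one_mul_smoothTransition {δ : ℝ} (hδ : 0 < δ) :
    Monotone fun s : ℝ => (s - 1) * Real.smoothTransition ((s - 1) / δ - 1) := by
  intro x y hxy
  have hm : Real.smoothTransition ((x - 1) / δ - 1) ≤ Real.smoothTransition ((y - 1) / δ - 1) :=
    Real.smoothTransition.monotone (by gcongr)
  have hn := Real.smoothTransition.nonneg ((y - 1) / δ - 1)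
  have hz : ∀ s ≤ 1, Real.smoothTransition ((s - 1) / δ - 1) = 0 := fun s hs =>
    Real.smoothTransition.zero_of_nonpos (by
      have : (s - 1) / δ ≤ 0 := div_nonpos_of_nonpos_of_nonneg (by linarith) hδ.le
      linarith)
  show (x - 1) * _ ≤ (y - 1) * _
  rcases le_total x 1 with hx | hx
  · rw [hz x hx, mul_zero]
    rcases le_total y 1 with hy | hy
    · rw [hz y hy, mul_zero]
    · exact mul_nonneg (by linarith) hn
  · exact mul_le_mul (by linarith) hm (Real.smoothTransition.nonneg _) (by linarith)

/-! ### Weighted circulation -/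

/-- The Jacobian determinant of a map with partial derivatives `Gt` and `Gs`. -/
noncomputable def jac (Gt Gs : ℝ → ℝ → ℂ) (t s : ℝ) : ℝ := (conj (Gt t s) * Gs t s).im

/-- The circulation of `χ(|w - a|²) d arg(w - a)` along the images of the circles. -/
noncomputable def circulation (G Gs : ℝ → ℝ → ℂ) (χ : ℝ → ℝ) (a : ℂ) (t : ℝ) : ℝ :=
  ∫ s in (0 : ℝ)..2 * π,
    χ (‖G t s - a‖ ^ 2) / ‖G t s - a‖ ^ 2 * (conj (G t s - a) * Gs t s).im

theorem im_div_eq (z w : ℂ) : (w / z).im = (conj z * w).im / ‖z‖ ^ 2 := by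
  rw [Complex.div_im, Complex.sq_norm]
  simp only [Complex.mul_im, Complex.conj_re, Complex.conj_im]
  ring

namespace IsPeriodicHarmonic

variable {ℓ : ℝ} {G Gt Gs Gtt Gts Gss : ℝ → ℝ → ℂ}
  (hG : IsPeriodicHarmonic ℓ G Gt Gs Gtt Gts Gss)

include hG

theorem closed {t : ℝ} : G t (2 * π) = G t 0 := by simpa using hG.periodic t 0

/-- Green's formula in infinitesimal form: with `κ(s) = χ(s) / s`, the form `κ(|w|²) Im (conj w dw)`
has exterior derivative `2 (κ + s κ')(|w|²) = 2 χ'(|w|²)` times the area form, and the Jacobian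
comes from pulling back by `G`. -/
theorem hasDerivAt_circulation {χ : ℝ → ℝ} (hχ : ContDiff ℝ 1 χ) {b : ℝ} (hb : 0 < b)
    (h0 : ∀ s ≤ b, χ s = 0) (a : ℂ) {t : ℝ} (ht : t ∈ Ioo 0 ℓ) :
    HasDerivAt (circulation G Gs χ a)
      (∫ s in (0 : ℝ)..2 * π, 2 * (deriv χ (‖G t s - a‖ ^ 2) * jac Gt Gs t s)) t := by
  set κ : ℝ → ℝ := fun s => χ s / s with hκd
  have hκ : ContDiff ℝ 1 κ := contDiff_div_id_of_eq_zero hχ hb h0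
  have hκ1 : Continuous κ := hκ.continuous
  have hκ2 : Continuous (deriv κ) := hκ.continuous_deriv le_rfl
  have hκχ : ∀ s, κ s + s * deriv κ s = deriv χ s := div_id_add_mul_deriv_div_id hχ hb h0
  have key : ∀ {u v : ℝ → ℂ} {u' v' : ℂ} {x : ℝ}, HasDerivAt u u' x → HasDerivAt v v' x →
      HasDerivAt (fun x => κ (‖u x - a‖ ^ 2) * (conj (u x - a) * v x).im)
        (deriv κ (‖u x - a‖ ^ 2) * (2 * (conj (u x - a) * u').re) * (conj (u x - a) * v x).im +
          κ (‖u x - a‖ ^ 2) * (conj u' * v x + conj (u x - a) * v').im) x := by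
    intro u v u' v' x hu hv
    have hk := hu.sub_const a
    have h1 := (hκ.differentiable one_ne_zero (‖u x - a‖ ^ 2)).hasDerivAt.comp x hk.norm_sq
    refine (h1.mul (hasDerivAt_im (hasDerivAt_conj_mul hk hv))).congr_deriv ?_
    rw [Complex.inner, mul_comm (starRingEnd ℂ (u x - a)) u']
    rfl
  have cim : ∀ {A B : ℝ × ℝ → ℂ}, ContinuousOn A (Ioo 0 ℓ ×ˢ univ) →
      ContinuousOn B (Ioo 0 ℓ ×ˢ univ) →
      ContinuousOn (fun p => (conj (A p) * B p).im) (Ioo 0 ℓ ×ˢ univ) :=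
    fun hA hB => Complex.continuous_im.comp_continuousOn
      ((Complex.continuous_conj.comp_continuousOn hA).mul hB)
  have cre : ∀ {A B : ℝ × ℝ → ℂ}, ContinuousOn A (Ioo 0 ℓ ×ˢ univ) →
      ContinuousOn B (Ioo 0 ℓ ×ˢ univ) →
      ContinuousOn (fun p => (conj (A p) * B p).re) (Ioo 0 ℓ ×ˢ univ) :=
    fun hA hB => Complex.continuous_re.comp_continuousOn
      ((Complex.continuous_conj.comp_continuousOn hA).mul hB)
  have hk : ContinuousOn (fun p : ℝ × ℝ => G p.1 p.2 - a) (Ioo 0 ℓ ×ˢ univ) :=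
    hG.cont.sub continuousOn_const
  have hκk : ContinuousOn (fun p : ℝ × ℝ => κ (‖G p.1 p.2 - a‖ ^ 2)) (Ioo 0 ℓ ×ˢ univ) :=
    hκ1.comp_continuousOn (hk.norm.pow 2)
  have hκ'k : ContinuousOn (fun p : ℝ × ℝ => deriv κ (‖G p.1 p.2 - a‖ ^ 2)) (Ioo 0 ℓ ×ˢ univ) :=
    hκ2.comp_continuousOn (hk.norm.pow 2)
  have h := hasDerivAt_intervalIntegral_of_continuousOn (a := 0) (b := 2 * π) isOpen_Ioo
    (F := fun t s => κ (‖G t s - a‖ ^ 2) * (conj (G t s - a) * Gs t s).im)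
    (F' := fun t s => deriv κ (‖G t s - a‖ ^ 2) * (2 * (conj (G t s - a) * Gt t s).re) *
        (conj (G t s - a) * Gs t s).im +
          κ (‖G t s - a‖ ^ 2) * (conj (Gt t s) * Gs t s + conj (G t s - a) * Gts t s).im)
    (hκk.mul (cim hk hG.cont_s))
    (((hκ'k.mul ((continuousOn_const (c := (2 : ℝ))).mul (cre hk hG.cont_t))).mul (cim hk hG.cont_s)).add
      (hκk.mul (Complex.continuous_im.comp_continuousOn
        (((Complex.continuous_conj.comp_continuousOn hG.cont_t).mul hG.cont_s).add
          ((Complex.continuous_conj.comp_continuousOn hk).mul hG.cont_ts)))))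
    (fun x hx s => key (hG.deriv_t x hx s) (hG.deriv_ts x hx s)) ht
  refine h.congr_deriv ?_
  have c0 := continuous_slice hG.cont ht
  have c1 := continuous_slice hG.cont_t ht
  have c2 := continuous_slice hG.cont_s ht
  have c3 := continuous_slice hG.cont_ts ht
  -- The same expression with `Gt` in place of `Gs` has an `s`-derivative of zero integral;
  -- subtracting it cancels the mixed derivative `Gts`.
  have hs := fun s => key (hG.deriv_s t ht s) (hG.deriv_st t ht s)
  have hz := intervalIntegral.integral_eq_sub_of_hasDerivAt (a := 0) (b := 2 * π)
    (fun s _ => hs s) (Continuous.intervalIntegrable (by fun_prop) _ _)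
  have p1 : Gt t (2 * π) = Gt t 0 := by simpa using hG.periodic_t t 0
  rw [hG.closed, p1, sub_self] at hz
  refine (sub_zero _).symm.trans ((congrArg (HSub.hSub _) hz.symm).trans ?_)
  rw [← intervalIntegral.integral_sub
    (Continuous.intervalIntegrable (by fun_prop) _ _)
    (Continuous.intervalIntegrable (by fun_prop) _ _)]
  congr 1
  funext s
  rw [← hκχ, jac, Complex.sq_norm, Complex.normSq_apply]
  simp only [Complex.mul_re, Complex.mul_im, Complex.conj_re, Complex.conj_im, Complex.add_im]
  ring

theorem continuous_circulation_density {χ : ℝ → ℝ} (hχ : ContDiff ℝ 1 χ) (a : ℂ) {t : ℝ}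
    (ht : t ∈ Ioo 0 ℓ) :
    Continuous fun s => 2 * (deriv χ (‖G t s - a‖ ^ 2) * jac Gt Gs t s) := by
  have c0 := continuous_slice hG.cont ht
  have c1 := continuous_slice hG.cont_t ht
  have c2 := continuous_slice hG.cont_s ht
  have := hχ.continuous_deriv le_rfl
  unfold jac
  fun_prop

variable (hJ : ∀ t ∈ Ioo 0 ℓ, ∀ s, 0 ≤ jac Gt Gs t s)

include hJ

theorem monotoneOn_circulation {χ : ℝ → ℝ} (hχ : ContDiff ℝ 1 χ) (hm : Monotone χ) {b : ℝ}
    (hb : 0 < b) (h0 : ∀ s ≤ b, χ s = 0) (a : ℂ) :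
    MonotoneOn (circulation G Gs χ a) (Ioo 0 ℓ) := by
  refine monotoneOn_of_deriv_nonneg (convex_Ioo 0 ℓ)
    (fun x hx => (hG.hasDerivAt_circulation hχ hb h0 a hx).continuousAt.continuousWithinAt)
    (fun x hx => ?_) (fun x hx => ?_) <;> rw [interior_Ioo] at hx
  · exact (hG.hasDerivAt_circulation hχ hb h0 a hx).differentiableAt.differentiableWithinAt
  · rw [(hG.hasDerivAt_circulation hχ hb h0 a hx).deriv]
    exact intervalIntegral.integral_nonneg two_pi_pos.le fun s _ =>
      mul_nonneg zero_le_two (mul_nonneg hm.deriv_nonneg (hJ x hx s))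

/-- Equality case of the monotonicity: the circulation is constant in between, so its nonnegative
continuous density vanishes. -/
theorem deriv_mul_jac_eq_zero {χ : ℝ → ℝ} (hχ : ContDiff ℝ 1 χ) (hm : Monotone χ) {b : ℝ}
    (hb : 0 < b) (h0 : ∀ s ≤ b, χ s = 0) (a : ℂ) {t₁ t₂ : ℝ} (ht₁ : t₁ ∈ Ioo 0 ℓ)
    (ht₂ : t₂ ∈ Ioo 0 ℓ) (heq : circulation G Gs χ a t₁ = circulation G Gs χ a t₂) {t : ℝ}
    (ht : t ∈ Ioo t₁ t₂) (s : ℝ) : deriv χ (‖G t s - a‖ ^ 2) * jac Gt Gs t s = 0 := by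
  have hmono := hG.monotoneOn_circulation hJ hχ hm hb h0 a
  have hsub : Ioo t₁ t₂ ⊆ Ioo 0 ℓ := fun x hx => ⟨ht₁.1.trans hx.1, hx.2.trans ht₂.2⟩
  have hconst : circulation G Gs χ a =ᶠ[𝓝 t] fun _ => circulation G Gs χ a t₁ := by
    filter_upwards [Ioo_mem_nhds ht.1 ht.2] with x hx
    exact le_antisymm ((hmono (hsub hx) ht₂ hx.2.le).trans heq.ge) (hmono ht₁ (hsub hx) hx.1.le)
  have hd := (hG.hasDerivAt_circulation hχ hb h0 a (hsub ht)).unique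
    ((hasDerivAt_const t _).congr_of_eventuallyEq hconst)
  have hper : Function.Periodic (fun s => deriv χ (‖G t s - a‖ ^ 2) * jac Gt Gs t s) (2 * π) :=
    fun s => by
      simp only [jac, hG.periodic t s, hG.periodic_t t s, hG.periodic_s t s]
  obtain ⟨s', hs', hss'⟩ := hper.exists_mem_Ico₀ two_pi_pos s
  refine hss'.trans ?_
  have hnn : ∀ s, 0 ≤ deriv χ (‖G t s - a‖ ^ 2) * jac Gt Gs t s := fun s =>
    mul_nonneg hm.deriv_nonneg (hJ t (hsub ht) s)
  by_contra hne
  refine (intervalIntegral.integral_pos two_pi_pos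
    (hG.continuous_circulation_density hχ a (hsub ht)).continuousOn
    (fun s _ => mul_nonneg zero_le_two (hnn s)) ⟨s', Ico_subset_Icc_self hs', ?_⟩).ne' hd
  exact mul_pos two_pos (lt_of_le_of_ne (hnn s') (Ne.symm hne))

omit hJ in
theorem circulation_eq_im_integral {χ : ℝ → ℝ} {a : ℂ} {t : ℝ} (ht : t ∈ Ioo 0 ℓ)
    (h1 : ∀ s, χ (‖G t s - a‖ ^ 2) = 1) (hne : ∀ s, G t s - a ≠ 0) :
    circulation G Gs χ a t = (∫ s in (0 : ℝ)..2 * π, Gs t s / (G t s - a)).im := by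
  have c0 := continuous_slice hG.cont ht
  have c2 := continuous_slice hG.cont_s ht
  have hi : IntervalIntegrable (fun s => Gs t s / (G t s - a)) volume 0 (2 * π) :=
    (c2.div (c0.sub continuous_const) hne).intervalIntegrable _ _
  rw [← Complex.imCLM_apply, ← Complex.imCLM.intervalIntegral_comp_comm hi, circulation]
  congr 1
  funext s
  rw [h1, Complex.imCLM_apply, im_div_eq, one_div, div_eq_inv_mul]

/-- The images of the circles wind at least once around the origin. -/
theorem two_pi_le_im_integral_div
    (hJ' : ∀ V : Set (ℝ × ℝ), IsOpen V → V.Nonempty → V ⊆ Ioo 0 ℓ ×ˢ univ →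
      ∃ p ∈ V, jac Gt Gs p.1 p.2 ≠ 0)
    (hgt : ∀ t ∈ Ioo 0 ℓ, ∀ s, 1 < ‖G t s‖)
    (hlim : ∀ r : ℝ, 1 < r → ∃ t₀ > 0, ∀ t ∈ Ioo 0 t₀, ∀ s, ‖G t s‖ < r) {t₂ : ℝ}
    (ht₂ : t₂ ∈ Ioo 0 ℓ) :
    2 * π ≤ (∫ s in (0 : ℝ)..2 * π, Gs t₂ s / G t₂ s).im := by
  have c0 := continuous_slice hG.cont ht₂
  have c2 := continuous_slice hG.cont_s ht₂
  obtain ⟨r, hr1, hr⟩ : ∃ r : ℝ, 1 < r ∧ ∀ s, r ≤ ‖G t₂ s‖ := by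
    obtain ⟨s₀, hs₀⟩ := exists_forall_le_of_periodic c0.norm
      (fun s => congrArg norm (hG.periodic t₂ s))
    exact ⟨‖G t₂ s₀‖, hgt t₂ ht₂ s₀, hs₀⟩
  obtain ⟨τ, hτ, hτr⟩ := hlim r hr1
  set t₀ := min τ t₂ / 2 with ht₀d
  have hmin : 0 < min τ t₂ := lt_min hτ ht₂.1
  have ht₀τ : t₀ < τ := by linarith [min_le_left τ t₂]
  have ht₀t₂ : t₀ < t₂ := by linarith [min_le_right τ t₂]
  have ht₀0 : 0 < t₀ := by positivity
  have ht₀ : t₀ ∈ Ioo 0 ℓ := ⟨ht₀0, ht₀t₂.trans ht₂.2⟩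
  -- A value of `G` that separates two image curves: that of `t₁` stays in `|w| < |a|` and has
  -- winding number `0` about `a`; that of `t₂` stays in `|w| > |a|` and winds about `a` as often as
  -- about `0`.
  set a := G t₀ 0 with ha
  have har : ‖a‖ < r := hτr t₀ ⟨ht₀0, ht₀τ⟩ 0
  obtain ⟨τ', hτ', hτ'r⟩ := hlim ‖a‖ (hgt t₀ ht₀ 0)
  set t₁ := min τ' t₀ / 2 with ht₁d
  have hmin' : 0 < min τ' t₀ := lt_min hτ' ht₀0
  have ht₁τ : t₁ < τ' := by linarith [min_le_left τ' t₀]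
  have ht₁t₀ : t₁ < t₀ := by linarith [min_le_right τ' t₀]
  have ht₁0 : 0 < t₁ := by positivity
  have ht₁ : t₁ ∈ Ioo 0 ℓ := ⟨ht₁0, ht₁t₀.trans ht₀.2⟩
  have hlt₁ : ∀ s, ‖G t₁ s‖ < ‖a‖ := hτ'r t₁ ⟨ht₁0, ht₁τ⟩
  have hlt₂ : ∀ s, ‖a‖ < ‖G t₂ s‖ := fun s => har.trans_le (hr s)
  have hfar : ∀ t ∈ Ioo 0 ℓ, (∀ s, G t s - a ≠ 0) → ∃ m > 0, ∀ s, m ≤ ‖G t s - a‖ ^ 2 := by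
    intro t ht hne
    have c := continuous_slice hG.cont ht
    obtain ⟨s₀, hs₀⟩ := exists_forall_le_of_periodic (f := fun s => ‖G t s - a‖ ^ 2) (by fun_prop)
      (fun s => by simp only [hG.periodic t s])
    exact ⟨‖G t s₀ - a‖ ^ 2, by have := norm_pos_iff.2 (hne s₀); positivity, hs₀⟩
  have hne₁ : ∀ s, G t₁ s - a ≠ 0 := fun s => sub_ne_zero.2 fun h => (hlt₁ s).ne (by rw [h])
  have hne₂ : ∀ s, G t₂ s - a ≠ 0 := fun s => sub_ne_zero.2 fun h => (hlt₂ s).ne (by rw [h])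
  obtain ⟨m₁, hm₁, hm₁'⟩ := hfar t₁ ht₁ hne₁
  obtain ⟨m₂, hm₂, hm₂'⟩ := hfar t₂ ht₂ hne₂
  -- The cut-off rises from `0` at `η` to `1` at `2η`, so it is `1` on both end curves, where the
  -- circulation is `2π` times the winding number about `a`.
  set η := min m₁ m₂ / 2 with hηd
  have hη : 0 < η := half_pos (lt_min hm₁ hm₂)
  have hη₁ : 2 * η ≤ m₁ := by linarith [min_le_left m₁ m₂]
  have hη₂ : 2 * η ≤ m₂ := by linarith [min_le_right m₁ m₂]
  set χ : ℝ → ℝ := fun s => Real.smoothTransition (s / η - 1) with hχd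
  have hχ : ContDiff ℝ 1 χ :=
    Real.smoothTransition.contDiff.comp ((contDiff_id.div_const η).sub contDiff_const)
  have hχm : Monotone χ := fun x y hxy => Real.smoothTransition.monotone (by gcongr)
  have hχ0 : ∀ s ≤ η, χ s = 0 := fun s hs => Real.smoothTransition.zero_of_nonpos (by
    rw [sub_nonpos, div_le_one hη]; exact hs)
  have hχ1 : ∀ s, 2 * η ≤ s → χ s = 1 := fun s hs => Real.smoothTransition.one_of_one_le (by
    rw [le_sub_iff_add_le, le_div_iff₀ hη]; linarith)
  have e₁ : circulation G Gs χ a t₁ = 0 := by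
    rw [hG.circulation_eq_im_integral ht₁ (fun s => hχ1 _ (hη₁.trans (hm₁' s))) hne₁,
      integral_div_sub_eq_zero_of_norm_lt (hG.deriv_s t₁ ht₁) (continuous_slice hG.cont_s ht₁)
        hG.closed hlt₁, Complex.zero_im]
  have e₂ : circulation G Gs χ a t₂ = (∫ s in (0 : ℝ)..2 * π, Gs t₂ s / G t₂ s).im := by
    rw [hG.circulation_eq_im_integral ht₂ (fun s => hχ1 _ (hη₂.trans (hm₂' s))) hne₂,
      integral_div_sub_eq_of_norm_lt (hG.deriv_s t₂ ht₂) c2 hG.closed hlt₂]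
  have hle := hG.monotoneOn_circulation hJ hχ hχm hη hχ0 a ht₁ ht₂ (ht₁t₀.trans ht₀t₂).le
  have hpos : 0 < circulation G Gs χ a t₂ := by
    refine lt_of_le_of_ne (e₁ ▸ hle) fun heq => ?_
    have hvan := fun t (ht : t ∈ Ioo t₁ t₂) s =>
      hG.deriv_mul_jac_eq_zero hJ hχ hχm hη hχ0 a ht₁ ht₂ (e₁.trans heq) ht s
    obtain ⟨c, hc, hc'⟩ := exists_deriv_eq_slope χ (show η < 2 * η by linarith)
      hχ.continuous.continuousOn (hχ.differentiable one_ne_zero).differentiableOn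
    have hcpos : 0 < deriv χ c := by
      rw [hc', hχ0 η le_rfl, hχ1 (2 * η) le_rfl]
      exact div_pos (by norm_num) (by linarith)
    have hφ : ContinuousOn (fun p : ℝ × ℝ => ‖G p.1 p.2 - a‖ ^ 2) (Ioo 0 ℓ ×ˢ univ) :=
      (hG.cont.sub continuousOn_const).norm.pow 2
    have hsub : Ioo t₁ t₂ ⊆ Ioo 0 ℓ := fun x hx => ⟨ht₁0.trans hx.1, hx.2.trans ht₂.2⟩
    have hopen : IsOpen ((Ioo t₁ t₂ ×ˢ (univ : Set ℝ)) ∩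
        (fun p : ℝ × ℝ => ‖G p.1 p.2 - a‖ ^ 2) ⁻¹' {x | 0 < deriv χ x}) :=
      (hφ.mono (prod_mono hsub subset_rfl)).isOpen_inter_preimage (isOpen_Ioo.prod isOpen_univ)
        (isOpen_lt continuous_const (hχ.continuous_deriv le_rfl))
    -- Along `s = 0` the distance to `a` starts at `0`, so its square passes through the level `c`
    -- where `χ' > 0`. On the resulting nonempty open set the Jacobian would vanish identically.
    have hpath : ContinuousOn (fun t => ‖G t 0 - a‖ ^ 2) (Icc t₀ t₂) :=
      hφ.comp (f := fun t : ℝ => (t, (0 : ℝ))) (by fun_prop)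
        (fun t ht => ⟨⟨ht₀0.trans_le ht.1, ht.2.trans_lt ht₂.2⟩, mem_univ _⟩)
    obtain ⟨t, ht, htc⟩ := intermediate_value_Ioo ht₀t₂.le hpath (show c ∈ Ioo _ _ from
      ⟨by simp only [ha, sub_self]; simpa using hη.trans hc.1,
        hc.2.trans_le (hη₂.trans (hm₂' 0))⟩)
    obtain ⟨p, hp, hp'⟩ := hJ' _ hopen
      ⟨(t, 0), ⟨⟨⟨ht₁t₀.trans ht.1, ht.2⟩, mem_univ _⟩, by simpa [htc] using hcpos⟩⟩
      (inter_subset_left.trans (prod_mono hsub subset_rfl))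
    rcases mul_eq_zero.1 (hvan p.1 hp.1.1 p.2) with h | h
    · exact (ne_of_gt hp.2) h
    · exact hp' h
  obtain ⟨n, hn⟩ := exists_int_integral_div_eq (hG.deriv_s t₂ ht₂) c2
    (fun s => norm_pos_iff.1 ((zero_lt_one.trans (hgt t₂ ht₂ s)))) hG.closed
  rw [e₂, hn] at hpos
  rw [hn]
  have him : ((n : ℂ) * (2 * π * Complex.I)).im = n * (2 * π) := by simp
  rw [him] at hpos ⊢
  have hn1 : (1 : ℝ) ≤ n := by
    have : (0 : ℝ) < n := pos_of_mul_pos_left hpos two_pi_pos.le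
    exact_mod_cast this
  nlinarith [two_pi_pos]

/-- The images of the circles enclose at least the area of the unit disk. -/
theorem two_pi_le_sweptArea
    (hJ' : ∀ V : Set (ℝ × ℝ), IsOpen V → V.Nonempty → V ⊆ Ioo 0 ℓ ×ˢ univ →
      ∃ p ∈ V, jac Gt Gs p.1 p.2 ≠ 0)
    (hgt : ∀ t ∈ Ioo 0 ℓ, ∀ s, 1 < ‖G t s‖)
    (hlim : ∀ r : ℝ, 1 < r → ∃ t₀ > 0, ∀ t ∈ Ioo 0 t₀, ∀ s, ‖G t s‖ < r) {t₂ : ℝ}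
    (ht₂ : t₂ ∈ Ioo 0 ℓ) : 2 * π ≤ sweptArea G Gs t₂ := by
  refine (hG.two_pi_le_im_integral_div hJ hJ' hgt hlim ht₂).trans ?_
  have c0 := continuous_slice hG.cont ht₂
  have c2 := continuous_slice hG.cont_s ht₂
  obtain ⟨r, hr1, hr⟩ : ∃ r : ℝ, 1 < r ∧ ∀ s, r ≤ ‖G t₂ s‖ := by
    obtain ⟨s₀, hs₀⟩ := exists_forall_le_of_periodic c0.norm
      (fun s => congrArg norm (hG.periodic t₂ s))
    exact ⟨‖G t₂ s₀‖, hgt t₂ ht₂ s₀, hs₀⟩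
  -- Chosen so that `1 + 2δ = r²`: the weight is exactly `s - 1` on the curve of `t₂` and zero on
  -- curves close to the unit circle.
  set δ := (r ^ 2 - 1) / 2 with hδd
  have hδ : 0 < δ := by have : 1 < r ^ 2 := by nlinarith
                        simp only [hδd]; linarith
  set χ : ℝ → ℝ := fun s => (s - 1) * Real.smoothTransition ((s - 1) / δ - 1) with hχd
  have hχ : ContDiff ℝ 1 χ := (contDiff_id.sub contDiff_const).mul
    (Real.smoothTransition.contDiff.comp
      (((contDiff_id.sub contDiff_const).div_const δ).sub contDiff_const))
  have hχm : Monotone χ := monotone_sub_one_mul_smoothTransition hδ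
  have hχ0 : ∀ s ≤ 1 + δ, χ s = 0 := fun s hs => mul_eq_zero_of_right _
    (Real.smoothTransition.zero_of_nonpos (by
      rw [sub_nonpos, div_le_one hδ]; linarith))
  have hχ1 : ∀ s, r ^ 2 ≤ s → χ s = s - 1 := fun s hs => by
    simp only [hχd]
    rw [Real.smoothTransition.one_of_one_le, mul_one]
    rw [le_sub_iff_add_le, le_div_iff₀ hδ]
    linarith
  obtain ⟨τ, hτ, hτr⟩ := hlim (Real.sqrt (1 + δ)) (Real.lt_sqrt zero_le_one |>.2 (by linarith))
  set t₁ := min τ t₂ / 2 with ht₁d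
  have hmin : 0 < min τ t₂ := lt_min hτ ht₂.1
  have ht₁τ : t₁ < τ := by linarith [min_le_left τ t₂]
  have ht₁t₂ : t₁ < t₂ := by linarith [min_le_right τ t₂]
  have ht₁0 : 0 < t₁ := by positivity
  have ht₁ : t₁ ∈ Ioo 0 ℓ := ⟨ht₁0, ht₁t₂.trans ht₂.2⟩
  have e₁ : circulation G Gs χ 0 t₁ = 0 := by
    have : ∀ s, χ (‖G t₁ s - 0‖ ^ 2) = 0 := fun s => hχ0 _ (by
      rw [sub_zero]
      exact (Real.lt_sqrt (norm_nonneg _) |>.1 (hτr t₁ ⟨ht₁0, ht₁τ⟩ s)).le)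
    simp only [circulation, this, zero_div, zero_mul, intervalIntegral.integral_zero]
  have hne : ∀ s, G t₂ s ≠ 0 := fun s => norm_pos_iff.1 (zero_lt_one.trans (hgt t₂ ht₂ s))
  have hi : IntervalIntegrable (fun s => Gs t₂ s / G t₂ s) volume 0 (2 * π) :=
    (c2.div c0 hne).intervalIntegrable _ _
  -- With weight `s - 1` the density is `(1 - 1 / |G|²) Im (conj G · Gs)`: area minus winding.
  have e₂ : circulation G Gs χ 0 t₂ =
      sweptArea G Gs t₂ - (∫ s in (0 : ℝ)..2 * π, Gs t₂ s / G t₂ s).im := by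
    rw [← Complex.imCLM_apply, ← Complex.imCLM.intervalIntegral_comp_comm hi, sweptArea,
      ← intervalIntegral.integral_sub (Continuous.intervalIntegrable (by fun_prop) _ _)
        (Continuous.intervalIntegrable (by fun_prop (disch := assumption)) _ _), circulation]
    congr 1
    funext s
    have h1 : ‖G t₂ s‖ ^ 2 ≠ 0 := by have := norm_pos_iff.2 (hne s); positivity
    rw [sub_zero, hχ1 _ (pow_le_pow_left₀ (by linarith) (hr s) 2), Complex.imCLM_apply, im_div_eq,
      sub_div, div_self h1, sub_mul, one_mul, div_mul_eq_mul_div, one_mul]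
  have := hG.monotoneOn_circulation hJ hχ hχm (by linarith : 0 < 1 + δ) hχ0 0 ht₁ ht₂ ht₁t₂.le
  rw [e₁, e₂] at this
  linarith

end IsPeriodicHarmonic

/-! ### Logarithmic polar coordinates on the annulus -/

/-- The point with logarithmic polar coordinates `(t, s)`. -/
noncomputable def expPolar (t s : ℝ) : ℂ := Complex.exp (t + s * Complex.I)

theorem expPolar_eq_circleMap (t s : ℝ) : expPolar t s = circleMap 0 (exp t) s := by
  simp [expPolar, circleMap, Complex.exp_add]

theorem norm_expPolar (t s : ℝ) : ‖expPolar t s‖ = exp t := by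
  simp [expPolar, Complex.norm_exp]

theorem isOpen_annulus (R : ℝ) : IsOpen (annulus R) :=
  (isOpen_lt continuous_const continuous_norm).inter (isOpen_lt continuous_norm continuous_const)

theorem expPolar_mem_annulus {R : ℝ} (hR : 1 < R) {t : ℝ} (ht : t ∈ Ioo 0 (log R)) (s : ℝ) :
    expPolar t s ∈ annulus R := by
  refine ⟨?_, ?_⟩ <;> rw [norm_expPolar]
  · exact one_lt_exp_iff.2 ht.1
  · exact (lt_log_iff_exp_lt (by linarith)).1 ht.2

theorem continuous_expPolar : Continuous fun p : ℝ × ℝ => expPolar p.1 p.2 := by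
  unfold expPolar
  fun_prop

theorem periodic_expPolar (t : ℝ) : Function.Periodic (expPolar t) (2 * π) := fun s => by
  simp only [expPolar]
  rw [show ((t : ℂ) + ((s + 2 * π : ℝ) : ℂ) * Complex.I) =
    (t + s * Complex.I) + 2 * π * Complex.I by push_cast; ring]
  exact Complex.exp_periodic _

theorem hasDerivAt_expPolar_t (t s : ℝ) :
    HasDerivAt (fun t => expPolar t s) (expPolar t s) t := by
  have h1 : HasDerivAt (fun x : ℝ => (x : ℂ) + s * Complex.I) 1 t :=
    ((hasDerivAt_id (t : ℂ)).comp_ofReal).add_const _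
  simpa [expPolar] using h1.cexp

theorem hasDerivAt_expPolar_s (t s : ℝ) :
    HasDerivAt (expPolar t) (expPolar t s * Complex.I) s := by
  have h1 : HasDerivAt (fun x : ℝ => (t : ℂ) + x * Complex.I) (1 * Complex.I) s :=
    (((hasDerivAt_id (s : ℂ)).comp_ofReal).mul_const Complex.I).const_add _
  refine h1.cexp.congr_deriv ?_
  rw [one_mul, expPolar]

/-- The sum of the second derivatives along orthogonal directions of equal length. -/
theorem snd_deriv_add_of_laplacian (D : ℂ →L[ℝ] ℂ →L[ℝ] ℂ) (hD : D 1 1 + D Complex.I Complex.I = 0)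
    (z : ℂ) : D z z + D (z * Complex.I) (z * Complex.I) = 0 := by
  obtain ⟨x, y⟩ := z
  have h1 : (⟨x, y⟩ : ℂ) = x • (1 : ℂ) + y • Complex.I := by
    apply Complex.ext <;> simp
  have h2 : (⟨x, y⟩ : ℂ) * Complex.I = x • Complex.I - y • (1 : ℂ) := by
    apply Complex.ext <;> simp
  rw [h2, h1]
  simp only [map_add, map_sub, map_smul, add_apply, sub_apply, smul_apply]
  simp only [Complex.real_smul]
  linear_combination ((x : ℂ) ^ 2 + (y : ℂ) ^ 2) * hD

theorem hasDerivAt_clm_comp_apply {A : ℂ → ℂ →L[ℝ] ℂ} {A' : ℂ →L[ℝ] ℂ →L[ℝ] ℂ} {z v : ℝ → ℂ}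
    {z' v' : ℂ} {t : ℝ} (hA : HasFDerivAt A A' (z t)) (hz : HasDerivAt z z' t)
    (hv : HasDerivAt v v' t) :
    HasDerivAt (fun t => A (z t) (v t)) (A' z' (v t) + A (z t) v') t := by
  have h1 : HasDerivAt (fun t => A (z t)) (A' z') t := hA.comp_hasDerivAt t hz
  exact h1.clm_apply hv

/-- The exponential is conformal, so harmonicity survives: the second-order terms give `|z|²` times
the Laplacian, and the first-order terms in `z` and `i² z` cancel. -/
theorem isPeriodicHarmonic_of_harmonicOnNhd {R : ℝ} (hR : 1 < R) {h : ℂ → ℂ}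
    (hh : InnerProductSpace.HarmonicOnNhd h (annulus R)) :
    IsPeriodicHarmonic (log R) (fun t s => h (expPolar t s))
      (fun t s => fderiv ℝ h (expPolar t s) (expPolar t s))
      (fun t s => fderiv ℝ h (expPolar t s) (expPolar t s * Complex.I))
      (fun t s => fderiv ℝ (fderiv ℝ h) (expPolar t s) (expPolar t s) (expPolar t s) +
        fderiv ℝ h (expPolar t s) (expPolar t s))
      (fun t s => fderiv ℝ (fderiv ℝ h) (expPolar t s) (expPolar t s)
        (expPolar t s * Complex.I) + fderiv ℝ h (expPolar t s) (expPolar t s * Complex.I))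
      (fun t s => fderiv ℝ (fderiv ℝ h) (expPolar t s) (expPolar t s * Complex.I)
        (expPolar t s * Complex.I) +
          fderiv ℝ h (expPolar t s) (expPolar t s * Complex.I * Complex.I)) := by
  have hmem : ∀ t ∈ Ioo 0 (log R), ∀ s, expPolar t s ∈ annulus R := fun t ht s =>
    expPolar_mem_annulus hR ht s
  have hC2 : ContDiffOn ℝ 2 h (annulus R) := hh.contDiffOn
  have hC1 : ContDiffOn ℝ 1 (fderiv ℝ h) (annulus R) :=
    hC2.fderiv_of_isOpen (isOpen_annulus R) (by norm_num)
  have hC0 : ContinuousOn (fderiv ℝ (fderiv ℝ h)) (annulus R) :=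
    hC1.continuousOn_fderiv_of_isOpen (isOpen_annulus R) le_rfl
  have hd1 : ∀ z ∈ annulus R, HasFDerivAt h (fderiv ℝ h z) z := fun z hz =>
    ((hC2.contDiffAt ((isOpen_annulus R).mem_nhds hz)).differentiableAt two_ne_zero).hasFDerivAt
  have hd2 : ∀ z ∈ annulus R, HasFDerivAt (fderiv ℝ h) (fderiv ℝ (fderiv ℝ h) z) z := fun z hz =>
    ((hC1.contDiffAt ((isOpen_annulus R).mem_nhds hz)).differentiableAt one_ne_zero).hasFDerivAt
  have hmaps : MapsTo (fun p : ℝ × ℝ => expPolar p.1 p.2) (Ioo 0 (log R) ×ˢ univ) (annulus R) :=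
    fun p hp => hmem p.1 hp.1 p.2
  have c := continuous_expPolar.continuousOn (s := Ioo 0 (log R) ×ˢ (univ : Set ℝ))
  have ci : ContinuousOn (fun p : ℝ × ℝ => expPolar p.1 p.2 * Complex.I)
    (Ioo 0 (log R) ×ˢ univ) := c.mul continuousOn_const
  have c0 := hC2.continuousOn.comp c hmaps
  have c1 := hC1.continuousOn.comp c hmaps
  have c2 := hC0.comp c hmaps
  have hsymm : ∀ z ∈ annulus R, ∀ v w, fderiv ℝ (fderiv ℝ h) z v w = fderiv ℝ (fderiv ℝ h) z w v :=
    fun z hz v w => (hC2.contDiffAt ((isOpen_annulus R).mem_nhds hz)).isSymmSndFDerivAt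
      (by simp) v w
  constructor
  · exact c0
  · exact c1.clm_apply c
  · exact c1.clm_apply ci
  · exact ((c2.clm_apply c).clm_apply c).add (c1.clm_apply c)
  · exact ((c2.clm_apply c).clm_apply ci).add (c1.clm_apply ci)
  · exact ((c2.clm_apply ci).clm_apply ci).add (c1.clm_apply (ci.mul continuousOn_const))
  · exact fun t ht s => (hd1 _ (hmem t ht s)).comp_hasDerivAt t (hasDerivAt_expPolar_t t s)
  · exact fun t ht s => (hd1 _ (hmem t ht s)).comp_hasDerivAt s (hasDerivAt_expPolar_s t s)
  · exact fun t ht s => hasDerivAt_clm_comp_apply (z := fun t => expPolar t s)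
      (v := fun t => expPolar t s) (hd2 _ (hmem t ht s)) (hasDerivAt_expPolar_t t s)
      (hasDerivAt_expPolar_t t s)
  · exact fun t ht s => hasDerivAt_clm_comp_apply (z := fun t => expPolar t s)
      (v := fun t => expPolar t s * Complex.I) (hd2 _ (hmem t ht s)) (hasDerivAt_expPolar_t t s)
      ((hasDerivAt_expPolar_t t s).mul_const _)
  · intro t ht s
    refine (hasDerivAt_clm_comp_apply (z := expPolar t) (v := expPolar t) (hd2 _ (hmem t ht s))
      (hasDerivAt_expPolar_s t s) (hasDerivAt_expPolar_s t s)).congr_deriv ?_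
    rw [hsymm _ (hmem t ht s)]
  · exact fun t ht s => hasDerivAt_clm_comp_apply (z := expPolar t)
      (v := fun s => expPolar t s * Complex.I) (hd2 _ (hmem t ht s)) (hasDerivAt_expPolar_s t s)
      ((hasDerivAt_expPolar_s t s).mul_const _)
  · exact fun t s => by simp only [periodic_expPolar t s]
  · exact fun t s => by simp only [periodic_expPolar t s]
  · exact fun t s => by simp only [periodic_expPolar t s]
  · intro t ht s
    have hΔ := (hh _ (hmem t ht s)).2.eq_of_nhds
    rw [InnerProductSpace.laplacian_eq_iteratedFDeriv_complexPlane] at hΔ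
    simp only [iteratedFDeriv_two_apply, Matrix.cons_val_zero, Matrix.cons_val_one,
      Pi.zero_apply] at hΔ
    have h1 := snd_deriv_add_of_laplacian _ hΔ (expPolar t s)
    rw [mul_assoc, Complex.I_mul_I, mul_neg_one, map_neg]
    linear_combination h1

/-! ### Orientation -/

/-- The determinant of a real linear map of the complex plane. -/
theorem det_eq_im_conj_mul (L : ℂ →L[ℝ] ℂ) : L.det = (conj (L 1) * L Complex.I).im := by
  rw [ContinuousLinearMap.det, ← LinearMap.det_toMatrix Complex.basisOneI, Matrix.det_fin_two]
  simp [LinearMap.toMatrix_apply]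
  ring

/-- The Wirtinger splitting `L v = p v + q conj v`; the sign of the determinant tells which part
dominates. -/
theorem clm_apply_eq (L : ℂ →L[ℝ] ℂ) (v : ℂ) :
    L v = (L 1 - Complex.I * L Complex.I) / 2 * v +
      (L 1 + Complex.I * L Complex.I) / 2 * conj v := by
  obtain ⟨x, y⟩ := v
  have h1 : (⟨x, y⟩ : ℂ) = x • (1 : ℂ) + y • Complex.I := by
    apply Complex.ext <;> simp
  rw [h1]
  simp only [map_add, map_smul]
  simp only [Complex.real_smul, map_mul, Complex.conj_ofReal, map_one, Complex.conj_I]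
  linear_combination ((y : ℂ) * L Complex.I) * Complex.I_sq

theorem det_eq_norm_sq_sub (L : ℂ →L[ℝ] ℂ) :
    L.det = ‖(L 1 - Complex.I * L Complex.I) / 2‖ ^ 2 -
      ‖(L 1 + Complex.I * L Complex.I) / 2‖ ^ 2 := by
  rw [det_eq_im_conj_mul]
  simp only [norm_div, div_pow, Complex.sq_norm, Complex.normSq_apply, Complex.mul_re,
    Complex.mul_im, Complex.conj_re, Complex.conj_im, Complex.add_re, Complex.add_im,
    Complex.sub_re, Complex.sub_im, Complex.I_re, Complex.I_im]
  norm_num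
  ring

theorem jac_eq_norm_sq_mul_det (L : ℂ →L[ℝ] ℂ) (z : ℂ) :
    (conj (L z) * L (z * Complex.I)).im = ‖z‖ ^ 2 * L.det := by
  rw [det_eq_im_conj_mul]
  obtain ⟨x, y⟩ := z
  have h1 : (⟨x, y⟩ : ℂ) = x • (1 : ℂ) + y • Complex.I := by
    apply Complex.ext <;> simp
  have h2 : (⟨x, y⟩ : ℂ) * Complex.I = x • Complex.I - y • (1 : ℂ) := by
    apply Complex.ext <;> simp
  rw [h2, Complex.sq_norm, Complex.normSq_mk, h1]
  simp only [map_add, map_sub, map_smul]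
  simp only [Complex.real_smul, map_mul, Complex.conj_ofReal, Complex.mul_im, Complex.mul_re, Complex.add_re, Complex.add_im, Complex.sub_re, Complex.sub_im,
    Complex.conj_re, Complex.conj_im, Complex.ofReal_re, Complex.ofReal_im]
  ring

/-- A curve close to a negatively oriented circle does not have winding number `1`. -/
theorem not_hasWindingNumber_one {γ Q : ℝ → ℂ} {w c : ℂ} (hQ : Continuous Q)
    (hre : ∀ t, 0 < (Q t).re) (hper : Q (2 * π) = Q 0)
    (hγ : ∀ t, γ t - w = c * Complex.exp (-(t * Complex.I)) * Q t) :
    ¬ HasWindingNumber γ w 1 := by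
  rintro ⟨hne, φ, hφ, hφγ, hφ1⟩
  have hQ0 : ∀ t, Q t ≠ 0 := fun t h0 => by simpa [h0] using hre t
  have hc : c ≠ 0 := by
    rintro rfl
    exact hne 0 ⟨le_rfl, two_pi_pos.le⟩ (sub_eq_zero.1 (by rw [hγ]; simp))
  have hlog : Continuous fun t => (Complex.log (Q t)).im :=
    Complex.continuous_im.comp (hQ.clog fun t => Or.inl (hre t))
  -- A continuous argument of the constant `c`. It would have to be constant, yet it gains `2π` from
  -- `φ` and `2π` from `t`; halfway through the first turn the exponential has changed sign.
  set ψ : ℝ → ℝ := fun t => φ t + t - (Complex.log (Q t)).im with hψ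
  have hψc : ContinuousOn ψ (Icc 0 (2 * π)) :=
    (hφ.add continuousOn_id).sub hlog.continuousOn
  have hexp : ∀ t ∈ Icc 0 (2 * π), Complex.exp (ψ t * Complex.I) = c / ‖c‖ := by
    intro t ht
    have h1 := hφγ t ht
    have hn : ‖γ t - w‖ = ‖c‖ * ‖Q t‖ := by
      rw [hγ, norm_mul, norm_mul, ← neg_mul, ← Complex.ofReal_neg, Complex.norm_exp_ofReal_mul_I,
        mul_one]
    rw [hn, hγ] at h1
    have h2 : Q t = ‖Q t‖ * Complex.exp ((Complex.log (Q t)).im * Complex.I) := by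
      rw [Complex.log_im, Complex.norm_mul_exp_arg_mul_I]
    have h3 : ((‖Q t‖ : ℝ) : ℂ) ≠ 0 := by exact_mod_cast (norm_pos_iff.2 (hQ0 t)).ne'
    have h4 : ((‖c‖ : ℝ) : ℂ) ≠ 0 := by exact_mod_cast (norm_pos_iff.2 hc).ne'
    have h5 : Complex.exp (ψ t * Complex.I) = Complex.exp (φ t * Complex.I) *
        Complex.exp (t * Complex.I) * (Complex.exp ((Complex.log (Q t)).im * Complex.I))⁻¹ := by
      rw [← Complex.exp_neg, ← Complex.exp_add, ← Complex.exp_add]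
      congr 1
      simp only [hψ]
      push_cast
      ring
    rw [Complex.exp_neg] at h1
    have h6 := Complex.exp_ne_zero (t * Complex.I)
    have h7 := Complex.exp_ne_zero ((Complex.log (Q t)).im * Complex.I)
    rw [h5]
    generalize Complex.exp (t * Complex.I) = e₁ at *
    generalize Complex.exp ((Complex.log (Q t)).im * Complex.I) = e₂ at *
    generalize Complex.exp (φ t * Complex.I) = e₃ at *
    rw [eq_div_iff h4]
    field_simp at h1 ⊢
    refine mul_right_cancel₀ h3 ?_
    push_cast at h1
    linear_combination c * h2 - h1
  have hpi : (0 : ℝ) ≤ 2 * π := two_pi_pos.le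
  have hinc : ψ (2 * π) - ψ 0 = 4 * π := by
    simp only [hψ, hper]
    push_cast at hφ1
    linarith
  obtain ⟨t, ht, htπ⟩ := intermediate_value_Icc hpi hψc
    (show ψ 0 + π ∈ Icc (ψ 0) (ψ (2 * π)) from ⟨by linarith [pi_pos], by linarith [pi_pos]⟩)
  have h1 := hexp t ht
  rw [htπ, ← hexp 0 ⟨le_rfl, hpi⟩, Complex.ofReal_add, add_mul, Complex.exp_add,
    Complex.exp_pi_mul_I] at h1
  have h2 := Complex.exp_ne_zero (ψ 0 * Complex.I)
  exact h2 (by linear_combination (-1 / 2 : ℂ) * h1)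

/-- A negative determinant makes `q conj v` dominate the increment of `h`. On a small circle the
increment is then `q conj v` times a factor in the right half-plane, which winds `-1` times instead
of `1`. -/
theorem det_fderiv_nonneg {Ω : Set ℂ} (hΩ : IsOpen Ω) {h : ℂ → ℂ} (hor : OrientationPreservingOn h Ω)
    (hc : ContinuousOn h Ω) {z : ℂ} (hz : z ∈ Ω) (hd : DifferentiableAt ℝ h z) :
    0 ≤ (fderiv ℝ h z).det := by
  by_contra! hneg
  set L := fderiv ℝ h z with hL
  set p := (L 1 - Complex.I * L Complex.I) / 2 with hp
  set q := (L 1 + Complex.I * L Complex.I) / 2 with hq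
  have hLv : ∀ v, L v = p * v + q * conj v := clm_apply_eq L
  have hpq : ‖p‖ < ‖q‖ := by
    rw [det_eq_norm_sq_sub] at hneg
    exact lt_of_pow_lt_pow_left₀ 2 (norm_nonneg _) (by linarith)
  have hq0 : 0 < ‖q‖ := (norm_nonneg p).trans_lt hpq
  -- Half the gap, so that the linearization error and the `p` term together stay below `‖q‖ ε`.
  set κ := (‖q‖ - ‖p‖) / 2 with hκ
  have hκ0 : 0 < κ := by simp only [hκ]; linarith
  have hlittle := (hasFDerivAt_iff_isLittleO_nhds_zero.1 hd.hasFDerivAt).def hκ0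
  obtain ⟨δ₁, hδ₁, hb⟩ := Metric.eventually_nhds_iff.1 hlittle
  obtain ⟨δ₂, hδ₂, hball⟩ := Metric.isOpen_iff.1 hΩ z hz
  obtain ⟨ε, hwind, hε⟩ := ((hor z hz).and
    (Ioo_mem_nhdsGT (lt_min hδ₁ hδ₂))).exists
  have hε0 : 0 < ε := hε.1
  have hεC : ((ε : ℝ) : ℂ) ≠ 0 := by exact_mod_cast hε0.ne'
  have hqC : q ≠ 0 := norm_pos_iff.1 hq0
  set v : ℝ → ℂ := fun t => ε * Complex.exp (t * Complex.I) with hv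
  have hcm : ∀ t, circleMap z ε t = z + v t := fun t => rfl
  have hvn : ∀ t, ‖v t‖ = ε := fun t => by
    simp only [hv, norm_mul, Complex.norm_exp_ofReal_mul_I, mul_one, Complex.norm_real,
      Real.norm_of_nonneg hε0.le]
  have hvc : Continuous v := by simp only [hv]; fun_prop
  have hcont : Continuous fun t => h (z + v t) :=
    hc.comp_continuous (by fun_prop) fun t => hball (by
      rw [Metric.mem_ball, dist_eq_norm, add_sub_cancel_left, hvn]
      exact hε.2.trans_le (min_le_right _ _))
  have hconj : ∀ t, conj (v t) = ε * Complex.exp (-(t * Complex.I)) := fun t => by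
    simp only [hv, map_mul, Complex.conj_ofReal, ← Complex.exp_conj, Complex.conj_I, mul_neg]
  have hvc0 : ∀ t, conj (v t) ≠ 0 := fun t => by
    rw [hconj]; exact mul_ne_zero hεC (Complex.exp_ne_zero _)
  refine not_hasWindingNumber_one (Q := fun t => (h (z + v t) - h z) / (q * conj (v t)))
    (c := q * ε) ?_ ?_ ?_ ?_ hwind
  · exact (hcont.sub continuous_const).div
      (continuous_const.mul (Complex.continuous_conj.comp hvc))
      fun t => mul_ne_zero hqC (hvc0 t)
  · intro t
    have h1 := hb (y := v t) (by
      rw [dist_zero_right, hvn]; exact hε.2.trans_le (min_le_left _ _))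
    rw [hLv, hvn] at h1
    have h2 : ‖1 - (h (z + v t) - h z) / (q * conj (v t))‖ < 1 := by
      have e : 1 - (h (z + v t) - h z) / (q * conj (v t)) =
          -((h (z + v t) - h z - (p * v t + q * conj (v t))) + p * v t) / (q * conj (v t)) := by
        have := hvc0 t
        field_simp
        ring
      rw [e, norm_div, norm_neg, norm_mul, Complex.norm_conj, hvn,
        div_lt_one (mul_pos hq0 hε0)]
      calc _ ≤ κ * ε + ‖p‖ * ε := (norm_add_le _ _).trans (by
              rw [norm_mul, hvn]; gcongr)
        _ = (κ + ‖p‖) * ε := by ring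
        _ < ‖q‖ * ε := by gcongr; simp only [hκ]; linarith
    have h3 := re_one_sub_pos h2
    rwa [sub_sub_cancel] at h3
  · have : v (2 * π) = v 0 := by simp [hv, Complex.exp_two_pi_mul_I]
    simp only [this]
  · intro t
    simp only [hcm]
    rw [mul_assoc q, ← hconj, mul_div_cancel₀ _ (mul_ne_zero hqC (hvc0 t))]

/-! ### Boundary behavior and Jacobian of the maps in `ℋ(𝔸, 𝒜)` -/

theorem IsHalfRoundAnnulus.one_lt_norm {𝒜 : Set ℂ} (h𝒜 : IsHalfRoundAnnulus 𝒜) {w : ℂ}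
    (hw : w ∈ 𝒜) : 1 < ‖w‖ := by
  obtain ⟨outer, -, -, -, -, hcompl⟩ := h𝒜.compl_eq
  by_contra! hle
  have h1 : (w : OnePoint ℂ) ∈ (((↑) : ℂ → OnePoint ℂ) '' 𝒜)ᶜ := by
    rw [hcompl]
    exact Or.inl ⟨w, by simpa using hle, rfl⟩
  exact h1 ⟨w, hw, rfl⟩

/-- Near a boundary set whose cluster set lies in the unit circle, `h` is close to the unit
disk. -/
theorem eventually_norm_lt_of_clusterSet {h : ℂ → ℂ} {Ω C : Set ℂ}
    (hcl : clusterSet h Ω C ⊆ ((↑) : ℂ → OnePoint ℂ) '' Metric.sphere 0 1) {r : ℝ} (hr : 1 < r)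
    {ζ : ℂ} (hζ : ζ ∈ C) : ∀ᶠ z in 𝓝[Ω] ζ, ‖h z‖ < r := by
  by_contra hcon
  have hfreq : ∃ᶠ z in 𝓝[Ω] ζ, r ≤ ‖h z‖ := by
    simpa only [Filter.Frequently, not_le] using hcon
  have hne : NeBot (𝓝[Ω] ζ ⊓ 𝓟 {z | r ≤ ‖h z‖}) := frequently_mem_iff_neBot.1 hfreq
  -- By compactness of the sphere, values with `‖h z‖ ≥ r` accumulate somewhere; that point lies in
  -- the cluster set, hence on the unit circle, which is impossible.
  obtain ⟨w, hw⟩ := exists_clusterPt_of_compactSpace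
    (map (fun z => (h z : OnePoint ℂ)) (𝓝[Ω] ζ ⊓ 𝓟 {z | r ≤ ‖h z‖}))
  obtain ⟨w₀, hw₀, rfl⟩ := hcl ⟨ζ, hζ, hw.mono (map_mono inf_le_left)⟩
  have hU : IsOpen (((↑) : ℂ → OnePoint ℂ) '' Metric.ball 0 r) :=
    OnePoint.isOpenEmbedding_coe.isOpenMap _ Metric.isOpen_ball
  have hmem : ((↑) : ℂ → OnePoint ℂ) '' Metric.ball 0 r ∈ 𝓝 (w₀ : OnePoint ℂ) :=
    hU.mem_nhds ⟨w₀, by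
      rw [mem_ball_zero_iff, mem_sphere_zero_iff_norm.1 hw₀]
      exact hr, rfl⟩
  have h1 : (fun z => (h z : OnePoint ℂ)) '' {z | r ≤ ‖h z‖} ∈
      map (fun z => (h z : OnePoint ℂ)) (𝓝[Ω] ζ ⊓ 𝓟 {z | r ≤ ‖h z‖}) :=
    image_mem_map (mem_inf_of_right (mem_principal_self _))
  obtain ⟨_, ⟨u, hu, rfl⟩, z, hz, hzu⟩ := clusterPt_iff_nonempty.1 hw hmem h1
  have : h z = u := OnePoint.coe_injective hzu
  rw [mem_ball_zero_iff, ← this] at hu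
  exact absurd hu (not_lt.2 hz)

namespace IsHarmonicMap

variable {R : ℝ} {𝒜 : Set ℂ} {h : ℂ → ℂ}

theorem one_lt_norm (hh : IsHarmonicMap R 𝒜 h) (h𝒜 : IsHalfRoundAnnulus 𝒜) {z : ℂ}
    (hz : z ∈ annulus R) : 1 < ‖h z‖ :=
  h𝒜.one_lt_norm (hh.image_eq ▸ mem_image_of_mem h hz)

/-- Compactness of the inner circle makes the pointwise boundary bound uniform in the angle. -/
theorem exists_norm_lt (hh : IsHarmonicMap R 𝒜 h) (hR : 1 < R) {r : ℝ} (hr : 1 < r) :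
    ∃ t₀ > 0, ∀ t ∈ Ioo 0 t₀, ∀ s, ‖h (expPolar t s)‖ < r := by
  have hU : {z | z ∈ annulus R → ‖h z‖ < r} ∈ 𝓝ˢ (Metric.sphere (0 : ℂ) 1) := by
    rw [mem_nhdsSet_iff_forall]
    intro ζ hζ
    exact eventually_nhdsWithin_iff.1 (eventually_norm_lt_of_clusterSet hh.cluster_inner.le hr hζ)
  obtain ⟨δ, hδ, hsub⟩ := (Metric.hasBasis_nhdsSet_thickening (isCompact_sphere (0 : ℂ) 1)).mem_iff.1
    hU
  refine ⟨min (log R) (log (1 + δ)), lt_min (log_pos hR) (log_pos (by linarith)),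
    fun t ht s => ?_⟩
  refine hsub ?_ (expPolar_mem_annulus hR ⟨ht.1, ht.2.trans_le (min_le_left _ _)⟩ s)
  rw [Metric.mem_thickening_iff]
  refine ⟨expPolar 0 s, by simp [norm_expPolar], ?_⟩
  have h1 : expPolar t s = (exp t : ℂ) * expPolar 0 s := by
    simp [expPolar, Complex.exp_add]
  have h2 : exp t < 1 + δ :=
    (lt_log_iff_exp_lt (by linarith)).1 (ht.2.trans_le (min_le_right _ _))
  have h3 : 1 < exp t := one_lt_exp_iff.2 ht.1
  rw [dist_eq_norm, h1, ← sub_one_mul, norm_mul, norm_expPolar, Real.exp_zero, mul_one,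
    ← Complex.ofReal_one, ← Complex.ofReal_sub, Complex.norm_real,
    Real.norm_of_nonneg (by linarith)]
  linarith

theorem differentiableAt (hh : IsHarmonicMap R 𝒜 h) {z : ℂ} (hz : z ∈ annulus R) :
    DifferentiableAt ℝ h z :=
  ((hh.harmonic.contDiffOn.contDiffAt ((isOpen_annulus R).mem_nhds hz)).differentiableAt
    two_ne_zero)

theorem det_nonneg (hh : IsHarmonicMap R 𝒜 h) {z : ℂ} (hz : z ∈ annulus R) :
    0 ≤ (fderiv ℝ h z).det :=
  det_fderiv_nonneg (isOpen_annulus R) hh.orientation hh.harmonic.contDiffOn.continuousOn hz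
    (hh.differentiableAt hz)

theorem isOpen_image (hh : IsHarmonicMap R 𝒜 h) (h𝒜 : IsHalfRoundAnnulus 𝒜) {S : Set ℂ}
    (hS : IsOpen S) (hsub : S ⊆ annulus R) : IsOpen (h '' S) := by
  have hemb : IsOpenEmbedding ((annulus R).domRestrict h) :=
    ⟨hh.isEmbedding, by rw [range_domRestrict, hh.image_eq]; exact h𝒜.isOpen⟩
  have h1 := hemb.isOpenMap _ (hS.preimage (continuous_subtype_val (p := (· ∈ annulus R))))
  convert h1 using 1
  ext w
  constructor
  · rintro ⟨z, hz, rfl⟩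
    exact ⟨⟨z, hsub hz⟩, hz, rfl⟩
  · rintro ⟨z, hz, rfl⟩
    exact ⟨z, hz, rfl⟩

/-- The Jacobian determinant of a homeomorphism does not vanish identically on an open set. -/
theorem exists_det_ne_zero (hh : IsHarmonicMap R 𝒜 h) (h𝒜 : IsHalfRoundAnnulus 𝒜) {S : Set ℂ}
    (hS : IsOpen S) (hsub : S ⊆ annulus R) (hne : S.Nonempty) :
    ∃ z ∈ S, (fderiv ℝ h z).det ≠ 0 := by
  by_contra! hcon
  -- A vanishing determinant makes the image null, but the image is open and nonempty.
  have h1 : volume (h '' S) = 0 := addHaar_image_eq_zero_of_det_fderivWithin_eq_zero volume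
    (fun z hz => (hh.differentiableAt (hsub hz)).hasFDerivAt.hasFDerivWithinAt) hcon
  exact ((hh.isOpen_image h𝒜 hS hsub).measure_pos volume (hne.image h)).ne' h1

end IsHarmonicMap

/-! ### The mean outer radius -/

theorem circleAverage_norm_sq (h : ℂ → ℂ) {ρ : ℝ} (hρ : 0 < ρ) :
    Real.circleAverage (fun z => ‖h z‖ ^ 2) 0 ρ =
      (2 * π)⁻¹ * energy (fun t s => h (expPolar t s)) (log ρ) := by
  simp only [circleAverage_def, energy, expPolar_eq_circleMap, exp_log hρ, smul_eq_mul]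

theorem circleAverage_eq_fourierInt (h : ℂ → ℂ) (t : ℝ) :
    Real.circleAverage h 0 (exp t) =
      (2 * π)⁻¹ • fourierInt (fun s => h (expPolar t s)) 0 := by
  simp only [circleAverage_def, fourierInt_zero, expPolar_eq_circleMap]

theorem fderiv_expPolar_eq (h : ℂ → ℂ) (t s : ℝ) :
    fderiv ℝ h (expPolar t s) (expPolar t s) = exp t * radialDeriv h (expPolar t s) := by
  have h1 : expPolar t s / (‖expPolar t s‖ : ℂ) = (exp t)⁻¹ • expPolar t s := by
    rw [norm_expPolar, Complex.real_smul, Complex.ofReal_inv, div_eq_inv_mul]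
  rw [radialDeriv, h1, map_smul, Complex.real_smul, ← mul_assoc, ← Complex.ofReal_mul,
    mul_inv_cancel₀ (exp_pos t).ne', Complex.ofReal_one, one_mul]

theorem exists_isMeanOuterRadius_of_energy {R : ℝ} (hR : 1 < R) {h : ℂ → ℂ}
    (hmono : MonotoneOn (energy fun t s => h (expPolar t s)) (Ioo 0 (log R)))
    (hle : ∀ t ∈ Ioo 0 (log R), 2 * π * cosh t ^ 2 ≤ energy (fun t s => h (expPolar t s)) t) :
    ∃ L : ℝ≥0∞, IsMeanOuterRadius R h L ∧ ENNReal.ofReal (1 / 2 * (R + 1 / R)) ≤ L := by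
  have hlog : ∀ ρ ∈ Ioo 1 R, log ρ ∈ Ioo 0 (log R) := fun ρ hρ =>
    ⟨log_pos hρ.1, log_lt_log (by linarith [hρ.1]) hρ.2⟩
  have hm : MonotoneOn (fun ρ => ENNReal.ofReal
      (Real.sqrt (Real.circleAverage (fun z => ‖h z‖ ^ 2) 0 ρ))) (Ioo 1 R) := by
    intro x hx y hy hxy
    refine ENNReal.ofReal_le_ofReal (Real.sqrt_le_sqrt ?_)
    rw [circleAverage_norm_sq h (by linarith [hx.1]), circleAverage_norm_sq h (by linarith [hy.1])]
    exact mul_le_mul_of_nonneg_left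
      (hmono (hlog x hx) (hlog y hy) (log_le_log (by linarith [hx.1]) hxy)) (by positivity)
  -- In `[0, ∞]` a monotone function always has a left limit, possibly `∞`.
  have hlim := hm.tendsto_nhdsWithin_Ioo_left (nonempty_Ioo.2 hR) (OrderTop.bddAbove _)
  refine ⟨_, hlim, ?_⟩
  have hcosh : Tendsto (fun ρ => ENNReal.ofReal (cosh (log ρ))) (𝓝[<] R)
      (𝓝 (ENNReal.ofReal (1 / 2 * (R + 1 / R)))) := by
    have h1 : cosh (log R) = 1 / 2 * (R + 1 / R) := by
      rw [cosh_log (by linarith)]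
      ring
    rw [← h1]
    have h2 : ContinuousAt (fun ρ => cosh (log ρ)) R :=
      continuous_cosh.continuousAt.comp (continuousAt_log (by linarith))
    exact (ENNReal.continuous_ofReal.continuousAt.tendsto.comp h2.tendsto).mono_left
      nhdsWithin_le_nhds
  refine le_of_tendsto_of_tendsto hcosh hlim ?_
  filter_upwards [Ioo_mem_nhdsLT hR] with ρ hρ
  refine ENNReal.ofReal_le_ofReal (Real.le_sqrt_of_sq_le ?_)
  rw [circleAverage_norm_sq h (by linarith [hρ.1]), le_inv_mul_iff₀ two_pi_pos]
  exact hle _ (hlog ρ hρ)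

theorem two_pi_mul_le_energy {G : ℝ → ℝ → ℂ} {t c : ℝ} (hG : Continuous (G t)) (hc : 0 ≤ c)
    (h : ∀ s, c ≤ ‖G t s‖) : 2 * π * c ^ 2 ≤ energy G t := by
  have h1 := intervalIntegral.integral_mono (μ := volume) two_pi_pos.le
    (intervalIntegrable_const (c := c ^ 2)) ((hG.norm.pow 2).intervalIntegrable 0 (2 * π))
    (fun s => pow_le_pow_left₀ hc (h s) 2)
  simpa [energy] using h1

theorem energy_le_two_pi_mul {G : ℝ → ℝ → ℂ} {t c : ℝ} (hG : Continuous (G t))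
    (h : ∀ s, ‖G t s‖ ≤ c) : energy G t ≤ 2 * π * c ^ 2 := by
  have h1 := intervalIntegral.integral_mono (μ := volume) two_pi_pos.le
    ((hG.norm.pow 2).intervalIntegrable 0 (2 * π)) (intervalIntegrable_const (c := c ^ 2))
    (fun s => pow_le_pow_left₀ (norm_nonneg _) (h s) 2)
  simpa [energy] using h1

theorem IsHarmonicMap.tendsto_energy {R : ℝ} (hR : 1 < R) {𝒜 : Set ℂ}
    (h𝒜 : IsHalfRoundAnnulus 𝒜) {h : ℂ → ℂ} (hh : IsHarmonicMap R 𝒜 h) :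
    Tendsto (energy fun t s => h (expPolar t s)) (𝓝[>] 0) (𝓝 (2 * π)) := by
  have hcont : ∀ t ∈ Ioo 0 (log R), Continuous fun s => h (expPolar t s) := fun t ht =>
    continuous_slice (H := fun t s => h (expPolar t s))
      (isPeriodicHarmonic_of_harmonicOnNhd hR hh.harmonic).cont ht
  refine tendsto_order.2 ⟨fun b hb => ?_, fun b hb => ?_⟩
  · filter_upwards [Ioo_mem_nhdsGT (log_pos hR)] with t ht
    have := two_pi_mul_le_energy (G := fun t s => h (expPolar t s)) (hcont t ht) zero_le_one
      fun s => (hh.one_lt_norm h𝒜 (expPolar_mem_annulus hR ht s)).le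
    linarith
  · have h1 : 1 < (b / (2 * π) + 1) / 2 := by
      have : 1 < b / (2 * π) := (one_lt_div two_pi_pos).2 hb
      linarith
    -- The radius is chosen so that the energy bound becomes the midpoint of `2π` and `b`.
    obtain ⟨t₀, ht₀, hlt⟩ := hh.exists_norm_lt hR ((Real.lt_sqrt zero_le_one).2 (by simpa using h1))
    filter_upwards [Ioo_mem_nhdsGT ht₀, Ioo_mem_nhdsGT (log_pos hR)] with t ht ht'
    refine (energy_le_two_pi_mul (G := fun t s => h (expPolar t s)) (hcont t ht') fun s => (hlt t ht s).le).trans_lt ?_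
    rw [Real.sq_sqrt (by linarith)]
    have : 2 * π * ((b / (2 * π) + 1) / 2) = (b + 2 * π) / 2 := by
      field_simp
    linarith

end Nitsche

/-! ### The lower bound for the mean outer radius. -/

open Nitsche in
theorem mainTheorem3 (R : ℝ) (hR : 1 < R) (𝒜 : Set ℂ) (h𝒜 : Nitsche.IsHalfRoundAnnulus 𝒜)
    (h : ℂ → ℂ) (hh : Nitsche.IsHarmonicMapD R 𝒜 h ∨ Nitsche.IsHarmonicMapN R 𝒜 h) :
    ∃ L : ℝ≥0∞, Nitsche.IsMeanOuterRadius R h L ∧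
      ENNReal.ofReal (1 / 2 * (R + 1 / R)) ≤ L := by
  have hH : IsHarmonicMap R 𝒜 h := hh.elim And.left And.left
  have hG := isPeriodicHarmonic_of_harmonicOnNhd hR hH.harmonic
  have hgt : ∀ t ∈ Set.Ioo 0 (Real.log R), ∀ s, 1 < ‖h (expPolar t s)‖ := fun t ht s =>
    hH.one_lt_norm h𝒜 (expPolar_mem_annulus hR ht s)
  have hc : ∀ t ∈ Set.Ioo 0 (Real.log R),
      2 * Real.pi ≤ energy (fun t s => h (expPolar t s)) t := fun t ht => by
    simpa using two_pi_mul_le_energy (continuous_slice hG.cont ht) zero_le_one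
      fun s => (hgt t ht s).le
  have hlim := hH.tendsto_energy hR h𝒜
  refine exists_isMeanOuterRadius_of_energy hR (hG.monotoneOn_energy hc hlim) fun T hT => ?_
  rcases hh with ⟨-, hD⟩ | ⟨-, ρ, hρ, hN⟩
  · refine hG.cosh_sq_le_energy_of_average hc hlim ?_ hT
    have hexp : Tendsto Real.exp (𝓝[>] 0) (𝓝[>] 1) := by
      refine tendsto_nhdsWithin_iff.2 ⟨?_, ?_⟩
      · simpa using (Real.continuous_exp.tendsto 0).mono_left nhdsWithin_le_nhds
      · filter_upwards [self_mem_nhdsWithin] with t ht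
        exact Real.one_lt_exp_iff.2 ht
    have h1 := (hD.comp hexp).const_smul (2 * Real.pi)
    rw [smul_zero] at h1
    refine h1.congr fun t => ?_
    rw [Function.comp_apply, circleAverage_eq_fourierInt, smul_inv_smul₀ Real.two_pi_pos.ne']
  · have hJ : ∀ t s, jac (fun t s => fderiv ℝ h (expPolar t s) (expPolar t s))
        (fun t s => fderiv ℝ h (expPolar t s) (expPolar t s * Complex.I)) t s =
        Real.exp t ^ 2 * (fderiv ℝ h (expPolar t s)).det := fun t s => by
      rw [jac, jac_eq_norm_sq_mul_det, norm_expPolar]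
    have ht₀ : Real.log ρ ∈ Set.Ioo 0 (Real.log R) :=
      ⟨Real.log_pos hρ.1, Real.log_lt_log (by linarith [hρ.1]) hρ.2⟩
    refine hG.cosh_sq_le_energy_of_normal hc hlim (fun t ht => ?_) ht₀ ?_ hT
    · refine hG.two_pi_le_sweptArea (fun t ht s => ?_) (fun V hV hne hsub => ?_) hgt
        (fun r hr => hH.exists_norm_lt hR hr) ht
      · rw [hJ]
        exact mul_nonneg (sq_nonneg _) (hH.det_nonneg (expPolar_mem_annulus hR ht s))
      -- The complex exponential is an open map, so open sets of the strip correspond to open sets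
      -- of the annulus.
      · have hopen : IsOpen ((fun p : ℝ × ℝ => expPolar p.1 p.2) '' V) := by
          have h1 := Complex.isOpenMap_exp _
            (Complex.equivRealProdCLM.symm.toHomeomorph.isOpenMap V hV)
          rw [Set.image_image] at h1
          convert h1 using 3
          exact congrArg Complex.exp (Complex.equivRealProdCLM_symm_apply _).symm
        obtain ⟨_, ⟨p, hp, rfl⟩, hdet⟩ := hH.exists_det_ne_zero h𝒜 hopen
          (by rintro _ ⟨p, hp, rfl⟩; exact expPolar_mem_annulus hR (hsub hp).1 p.2) (hne.image _)
        refine ⟨p, hp, ?_⟩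
        rw [hJ]
        exact mul_ne_zero (pow_ne_zero 2 (Real.exp_pos _).ne') hdet
    · simp only [fderiv_expPolar_eq]
      rw [fourierInt_const_mul]
      refine mul_eq_zero_of_right _ ?_
      rw [← Real.exp_log (show 0 < ρ by linarith [hρ.1]), circleAverage_eq_fourierInt] at hN
      exact (smul_eq_zero.1 hN).resolve_left (inv_ne_zero Real.two_pi_pos.ne')
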